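/- Let $\mathbb K$ be $\mathbb R$ or $\mathbb C$. A topological $\mathbb K$-vector space is weakly complete if it is isomorphic to $\mathbb K^J$ (product topology) for some set $J$; a weakly complete unital algebra is an associative unital $\mathbb K$-algebra with a weakly complete topology and continuous multiplication, and it carries the Lie bracket $[a,b]=ab-ba$. A topological Lie algebra $\mathfrak g$ over $\mathbb K$ is profinite-dimensional if the natural map $\mathfrak g\to\lim_I\mathfrak g/I$, with $I$ running over the closed ideals of finite codimension, is an isomorphism of topological Lie algebras. Let $\mathfrak g\neq 0$ be profinite-dimensional. Its weakly complete enveloping algebra $\mathbf U(\mathfrak g)$ exists, that is, there is a weakly complete unital algebra $\mathbf U(\mathfrak g)$ with a continuous Lie algebra morphism $\lambda\colon\mathfrak g\to\mathbf U(\mathfrak g)$ such that every continuous Lie algebra morphism $f\colon\mathfrak g\to A$ into a weakly complete unital algebra $A$ is $f=f'\circ\lambda$ for a unique continuous unital algebra morphism $f'\colon\mathbf U(\mathfrak g)\to A$. Let $V\otimes_{\mathcal W}W=(V'\otimes W')^*$ (algebraic dual of the tensor product of the topological duals, with pointwise convergence) be the tensor product of weakly complete spaces. Let $c\colon\mathbf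 U(\mathfrak g)\to\mathbf U(\mathfrak g)\otimes_{\mathcal W}\mathbf U(\mathfrak g)$ and $k\colon\mathbf U(\mathfrak g)\to\mathbb K$ be the continuous unital algebra morphisms with $c(\lambda(x))=\lambda(x)\otimes1+1\otimes\lambda(x)$ and $k(\lambda(x))=0$ for $x\in\mathfrak g$. Call $a\in\mathbf U(\mathfrak g)$ grouplike if $c(a)=a\otimes a$ and $k(a)=1$. Then: 1. $\mathbf U(\mathfrak g)$ has a grouplike element different from $1$. 2. For every $x\in\mathfrak g$ the series $\exp\lambda(x)=\sum_{n\ge0}\frac1{n!}\lambda(x)^n$ converges, and $\exp\lambda(x)$ is grouplike. Moreover $\lambda\neq0$, and whenever $\lambda(x)\neq0$, one has $\exp\lambda(tx)\neq1$ for all sufficiently small $t\in\mathbb K\setminus\{0\}$. By contrast, for every Lie algebra $L$ over $\mathbb K$, the only grouplike element of the classical universal enveloping algebra $U(L)$, with the comultiplication determined by $x\mapsto x\otimes1+1\otimes x$ and the counit determined by $x\mapsto0$ for $x\in L$, is $1$. -/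

import Mathlib

open scoped TensorProduct Topology

universe u

noncomputable section

/-! ### Weakly complete vector spaces and their tensor product -/

/-- A topological vector space over `𝕜` is weakly complete if it is isomorphic, as a topological
vector space, to a power `𝕜 ^ J` with the product topology. -/
class WeaklyComplete (𝕜 : Type) [RCLike 𝕜] (E : Type u) [AddCommGroup E] [Module 𝕜 E]
    [TopologicalSpace E] : Prop where
  exists_equiv : ∃ J : Type u, Nonempty (E ≃L[𝕜] (J → 𝕜))

section Forms

variable {𝕜 : Type} [RCLike 𝕜]

/-- Evaluation of a functional at a point. -/
def dualEval (𝕜 : Type) [RCLike 𝕜] {E : Type u} [AddCommGroup E] [Module 𝕜 E] [TopologicalSpace E]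
    (a : E) : (E →L[𝕜] 𝕜) →ₗ[𝕜] 𝕜 where
  toFun φ := φ a
  map_add' _ _ := rfl
  map_smul' _ _ := rfl

@[simp] lemma dualEval_apply {E : Type u} [AddCommGroup E] [Module 𝕜 E] [TopologicalSpace E]
    (a : E) (φ : E →L[𝕜] 𝕜) : dualEval 𝕜 a φ = φ a := rfl

/-- The linear form `f ⊗ g` on `V ⊗ W`. -/
def formMul {V W : Type u} [AddCommGroup V] [Module 𝕜 V] [AddCommGroup W] [Module 𝕜 W]
    (f : V →ₗ[𝕜] 𝕜) (g : W →ₗ[𝕜] 𝕜) : V ⊗[𝕜] W →ₗ[𝕜] 𝕜 :=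
  LinearMap.mul' 𝕜 𝕜 ∘ₗ TensorProduct.map f g

@[simp] lemma formMul_tmul {V W : Type u} [AddCommGroup V] [Module 𝕜 V] [AddCommGroup W]
    [Module 𝕜 W] (f : V →ₗ[𝕜] 𝕜) (g : W →ₗ[𝕜] 𝕜) (v : V) (w : W) :
    formMul f g (v ⊗ₜ w) = f v * g w := rfl

/-- If families of forms separate the points of `V` and of `W`, the products separate those of
`V ⊗ W`. -/
lemma eq_zero_of_formMul {V W : Type u} [AddCommGroup V] [Module 𝕜 V] [AddCommGroup W]
    [Module 𝕜 W] {ι κ : Type*} (F : ι → V →ₗ[𝕜] 𝕜) (G : κ → W →ₗ[𝕜] 𝕜)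
    (hF : ∀ v, (∀ i, F i v = 0) → v = 0) (hG : ∀ w, (∀ i, G i w = 0) → w = 0)
    (z : V ⊗[𝕜] W) (hz : ∀ i j, formMul (F i) (G j) z = 0) : z = 0 := by
  classical
  let b := Module.Basis.ofVectorSpace 𝕜 W
  obtain ⟨c, rfl⟩ := (TensorProduct.equivFinsuppOfBasisRight (M := V) b).symm.surjective z
  have hc : c = 0 := by
    ext k
    refine hF _ fun i => ?_
    have h1 : (c.sum fun k v => F i v • b k) = 0 := by
      refine hG _ fun j => ?_
      have := hz i j
      rw [TensorProduct.equivFinsuppOfBasisRight_symm_apply] at this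
      simpa [Finsupp.sum, map_sum] using this
    have h2 := congrArg (fun w => b.repr w k) h1
    simp only [Finsupp.sum, map_sum, map_smul, Module.Basis.repr_self, Finsupp.smul_single,
      smul_eq_mul, mul_one, Finsupp.coe_finsetSum, Finset.sum_apply, Finsupp.single_apply,
      Finset.sum_ite_eq', map_zero, Finsupp.coe_zero, Pi.zero_apply] at h2
    by_cases hk : k ∈ c.support
    · simpa [hk] using h2
    · simp [Finsupp.notMem_support_iff.mp hk]
  simp [hc]

lemma eq_of_formMul {V W : Type u} [AddCommGroup V] [Module 𝕜 V] [AddCommGroup W]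
    [Module 𝕜 W] {ι κ : Type*} (F : ι → V →ₗ[𝕜] 𝕜) (G : κ → W →ₗ[𝕜] 𝕜)
    (hF : ∀ v, (∀ i, F i v = 0) → v = 0) (hG : ∀ w, (∀ i, G i w = 0) → w = 0)
    {z z' : V ⊗[𝕜] W} (hz : ∀ i j, formMul (F i) (G j) z = formMul (F i) (G j) z') : z = z' :=
  sub_eq_zero.mp <| eq_zero_of_formMul F G hF hG _ fun i j => by rw [map_sub, hz, sub_self]

lemma dualEval_sep {E : Type u} [AddCommGroup E] [Module 𝕜 E] [TopologicalSpace E]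
    (φ : E →L[𝕜] 𝕜) (h : ∀ a, dualEval 𝕜 a φ = 0) : φ = 0 :=
  ContinuousLinearMap.ext h

/-- A jointly continuous bilinear form on a weakly complete space is a finite sum of products of
continuous functionals. -/
lemma exists_tensor_of_bilin {E : Type u} [AddCommGroup E] [Module 𝕜 E] [TopologicalSpace E]
    [WeaklyComplete 𝕜 E] (β : E →ₗ[𝕜] E →ₗ[𝕜] 𝕜) (hβ : Continuous fun p : E × E => β p.1 p.2) :
    ∃ z : (E →L[𝕜] 𝕜) ⊗[𝕜] (E →L[𝕜] 𝕜),
      ∀ a b, formMul (dualEval 𝕜 a) (dualEval 𝕜 b) z = β a b := by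
  classical
  obtain ⟨J, ⟨e⟩⟩ := WeaklyComplete.exists_equiv (𝕜 := 𝕜) (E := E)
  have hc : Continuous fun p : (J → 𝕜) × (J → 𝕜) => β (e.symm p.1) (e.symm p.2) :=
    hβ.comp ((e.symm.continuous.comp continuous_fst).prodMk (e.symm.continuous.comp continuous_snd))
  have hn : {p : (J → 𝕜) × (J → 𝕜) | ‖β (e.symm p.1) (e.symm p.2)‖ < 1} ∈
      𝓝 ((0, 0) : (J → 𝕜) × (J → 𝕜)) := by
    refine (isOpen_lt hc.norm continuous_const).mem_nhds ?_
    simp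
  rw [nhds_prod_eq, Filter.mem_prod_same_iff] at hn
  obtain ⟨U, hU, hUU⟩ := hn
  have hU' := hU
  rw [nhds_pi, Filter.mem_pi'] at hU'
  obtain ⟨S, t, ht, hSt⟩ := hU'
  have hmem : ∀ x : J → 𝕜, (∀ i ∈ S, x i = 0) → x ∈ U := fun x hx =>
    hSt fun i hi => by rw [hx i hi]; exact mem_of_mem_nhds (ht i)
  have habs : ∀ y : J → 𝕜, ∃ s : 𝕜, s ≠ 0 ∧ s • y ∈ U := by
    intro y
    have h1 : Filter.Tendsto (fun s : 𝕜 => s • y) (𝓝 0) (𝓝 0) := by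
      have : Continuous fun s : 𝕜 => s • y := continuous_id.smul continuous_const
      simpa using this.tendsto 0
    have h2 : ∀ᶠ s in 𝓝[≠] (0 : 𝕜), s • y ∈ U := (h1.mono_left nhdsWithin_le_nhds) hU
    obtain ⟨s, hs, hs0⟩ := (h2.and self_mem_nhdsWithin).exists
    exact ⟨s, hs0, hs⟩
  have hsmall : ∀ c : 𝕜, (∀ s : 𝕜, ‖s * c‖ < 1) → c = 0 := by
    intro c h
    by_contra hc0
    have := h c⁻¹
    rw [inv_mul_cancel₀ hc0] at this
    simp at this
  have hl : ∀ x y : J → 𝕜, (∀ i ∈ S, x i = 0) → β (e.symm x) (e.symm y) = 0 := by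
    intro x y hx
    obtain ⟨s, hs0, hs⟩ := habs y
    have : β (e.symm x) (e.symm (s • y)) = 0 := hsmall _ fun r => by
      have hr : (r • x, s • y) ∈ U ×ˢ U :=
        ⟨hmem _ fun i hi => by simp [hx i hi], hs⟩
      have h3 := hUU hr
      simp only [Set.mem_ofPred_eq, map_smul, LinearMap.smul_apply, smul_eq_mul] at h3 ⊢
      rwa [mul_left_comm] at h3
    simpa [hs0] using this
  have hr : ∀ x y : J → 𝕜, (∀ i ∈ S, y i = 0) → β (e.symm x) (e.symm y) = 0 := by
    intro x y hy
    obtain ⟨s, hs0, hs⟩ := habs x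
    have : β (e.symm (s • x)) (e.symm y) = 0 := hsmall _ fun r => by
      have hr : (s • x, r • y) ∈ U ×ˢ U :=
        ⟨hs, hmem _ fun i hi => by simp [hy i hi]⟩
      simpa using hUU hr
    simpa [hs0] using this
  let P : (J → 𝕜) → (J → 𝕜) := fun x => ∑ i ∈ S, x i • (Pi.single i 1 : J → 𝕜)
  have hP : ∀ x, ∀ i ∈ S, (x - P x) i = 0 := by
    intro x i hi
    simp [P, Finset.sum_apply, Pi.single_apply, hi]
  have hβP : ∀ x y : J → 𝕜, β (e.symm x) (e.symm y) = β (e.symm (P x)) (e.symm (P y)) := by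
    intro x y
    have h1 := hl (x - P x) y (hP x)
    have h2 := hr (P x) (y - P y) (hP y)
    simp only [map_sub, LinearMap.sub_apply, sub_eq_zero] at h1 h2
    rw [h1, h2]
  let pr : J → (E →L[𝕜] 𝕜) := fun i => (ContinuousLinearMap.proj i).comp (e : E →L[𝕜] (J → 𝕜))
  refine ⟨∑ i ∈ S, ∑ j ∈ S, β (e.symm (Pi.single i 1)) (e.symm (Pi.single j 1)) •
    (pr i ⊗ₜ[𝕜] pr j), fun a b => ?_⟩
  have := hβP (e a) (e b)
  simp only [ContinuousLinearEquiv.symm_apply_apply, P, map_sum, map_smul, LinearMap.sum_apply,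
    LinearMap.smul_apply] at this
  rw [this]
  simp only [map_sum, map_smul, formMul_tmul, dualEval_apply, smul_eq_mul, Finset.mul_sum, pr,
    ContinuousLinearMap.comp_apply, ContinuousLinearMap.proj_apply]
  rw [Finset.sum_comm]
  refine Finset.sum_congr rfl fun i _ => Finset.sum_congr rfl fun j _ => ?_
  simp only [ContinuousLinearEquiv.coe_coe]
  ring

end Forms

section DualCoalgebra

variable {𝕜 : Type} [RCLike 𝕜] {A : Type u} [Ring A] [Algebra 𝕜 A] [TopologicalSpace A]
  [ContinuousMul A] [WeaklyComplete 𝕜 A]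

lemma exists_dualComul (φ : A →L[𝕜] 𝕜) : ∃ z : (A →L[𝕜] 𝕜) ⊗[𝕜] (A →L[𝕜] 𝕜),
    ∀ a b, formMul (dualEval 𝕜 a) (dualEval 𝕜 b) z = φ (a * b) :=
  exists_tensor_of_bilin ((LinearMap.mul 𝕜 A).compr₂ (φ : A →ₗ[𝕜] 𝕜))
    (φ.continuous.comp continuous_mul)

/-- The comultiplication on the topological dual `A'` of a weakly complete unital algebra `A`: the
transpose `A' → (A ⊗ A)' = A' ⊗ A'` of the multiplication of `A`. -/
def dualComul : (A →L[𝕜] 𝕜) →ₗ[𝕜] (A →L[𝕜] 𝕜) ⊗[𝕜] (A →L[𝕜] 𝕜) where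
  toFun φ := Classical.choose (exists_dualComul φ)
  map_add' φ ψ := by
    refine eq_of_formMul (dualEval 𝕜) (dualEval 𝕜) dualEval_sep dualEval_sep fun a b => ?_
    rw [map_add, Classical.choose_spec (exists_dualComul _),
      Classical.choose_spec (exists_dualComul _), Classical.choose_spec (exists_dualComul _)]
    rfl
  map_smul' c φ := by
    refine eq_of_formMul (dualEval 𝕜) (dualEval 𝕜) dualEval_sep dualEval_sep fun a b => ?_
    rw [map_smul, Classical.choose_spec (exists_dualComul _),
      Classical.choose_spec (exists_dualComul _)]
    rfl

lemma formMul_dualComul (φ : A →L[𝕜] 𝕜) (a b : A) :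
    formMul (dualEval 𝕜 a) (dualEval 𝕜 b) (dualComul φ) = φ (a * b) :=
  Classical.choose_spec (exists_dualComul φ) a b

/-- The topological dual of a weakly complete unital algebra is a coalgebra, by transposition. -/
instance dualCoalgebra : Coalgebra 𝕜 (A →L[𝕜] 𝕜) where
  comul := dualComul
  counit := dualEval 𝕜 1
  coassoc := by
    ext1 φ
    refine eq_of_formMul (κ := A × A) (dualEval 𝕜)
      (fun p => formMul (dualEval 𝕜 p.1) (dualEval 𝕜 p.2)) dualEval_sep
      (fun w hw => eq_zero_of_formMul (dualEval 𝕜) (dualEval 𝕜) dualEval_sep dualEval_sep w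
        fun i j => hw (i, j)) ?_
    rintro a ⟨b, c⟩
    have h1 : formMul (dualEval 𝕜 a) (formMul (dualEval 𝕜 b) (dualEval 𝕜 c)) ∘ₗ
        (TensorProduct.assoc 𝕜 (A →L[𝕜] 𝕜) (A →L[𝕜] 𝕜) (A →L[𝕜] 𝕜)).toLinearMap ∘ₗ
          dualComul.rTensor (A →L[𝕜] 𝕜) = formMul (dualEval 𝕜 (a * b)) (dualEval 𝕜 c) := by
      refine TensorProduct.ext' fun φ ψ => ?_
      rw [LinearMap.comp_apply, LinearMap.comp_apply, LinearMap.rTensor_tmul, formMul_tmul,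
        dualEval_apply, ← formMul_dualComul φ a b]
      generalize dualComul φ = z
      induction z with
      | zero => simp
      | tmul x y => simp [mul_assoc]
      | add x y hx hy => simp only [TensorProduct.add_tmul, map_add, hx, hy, add_mul]
    have h2 : formMul (dualEval 𝕜 a) (formMul (dualEval 𝕜 b) (dualEval 𝕜 c)) ∘ₗ
          dualComul.lTensor (A →L[𝕜] 𝕜) = formMul (dualEval 𝕜 a) (dualEval 𝕜 (b * c)) := by
      refine TensorProduct.ext' fun φ ψ => ?_
      rw [LinearMap.comp_apply, LinearMap.lTensor_tmul, formMul_tmul, formMul_tmul,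
        formMul_dualComul, dualEval_apply, dualEval_apply]
    have e1 := LinearMap.congr_fun h1 (dualComul φ)
    have e2 := LinearMap.congr_fun h2 (dualComul φ)
    rw [formMul_dualComul, mul_assoc] at e1
    rw [formMul_dualComul] at e2
    exact e1.trans e2.symm
  rTensor_counit_comp_comul := by
    ext1 φ
    apply (TensorProduct.lid 𝕜 (A →L[𝕜] 𝕜)).injective
    ext b
    have h : dualEval 𝕜 b ∘ₗ (TensorProduct.lid 𝕜 (A →L[𝕜] 𝕜)).toLinearMap ∘ₗ
        (dualEval 𝕜 (1 : A)).rTensor (A →L[𝕜] 𝕜) = formMul (dualEval 𝕜 1) (dualEval 𝕜 b) := by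
      refine TensorProduct.ext' fun φ ψ => ?_
      simp
    have e := LinearMap.congr_fun h (dualComul φ)
    rw [formMul_dualComul, one_mul] at e
    simpa using e
  lTensor_counit_comp_comul := by
    ext1 φ
    apply (TensorProduct.rid 𝕜 (A →L[𝕜] 𝕜)).injective
    ext b
    have h : dualEval 𝕜 b ∘ₗ (TensorProduct.rid 𝕜 (A →L[𝕜] 𝕜)).toLinearMap ∘ₗ
        (dualEval 𝕜 (1 : A)).lTensor (A →L[𝕜] 𝕜) = formMul (dualEval 𝕜 b) (dualEval 𝕜 1) := by
      refine TensorProduct.ext' fun φ ψ => ?_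
      simp [mul_comm]
    have e := LinearMap.congr_fun h (dualComul φ)
    rw [formMul_dualComul, mul_one] at e
    simpa using e

end DualCoalgebra

/-- The tensor product `E ⊗_W F = (E' ⊗ F')*` of weakly complete vector spaces: the algebraic dual
of the tensor product of the topological duals. -/
def WTensor (𝕜 : Type) [RCLike 𝕜] (E F : Type u) [AddCommGroup E] [Module 𝕜 E] [TopologicalSpace E]
    [AddCommGroup F] [Module 𝕜 F] [TopologicalSpace F] : Type u :=
  WithConv (((E →L[𝕜] 𝕜) ⊗[𝕜] (F →L[𝕜] 𝕜)) →ₗ[𝕜] 𝕜)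

namespace WTensor

section Space

variable {𝕜 : Type} [RCLike 𝕜] {E F : Type u} [AddCommGroup E] [Module 𝕜 E] [TopologicalSpace E]
    [AddCommGroup F] [Module 𝕜 F] [TopologicalSpace F]

/-- The topology of pointwise convergence. -/
instance : TopologicalSpace (WTensor 𝕜 E F) :=
  TopologicalSpace.induced (fun T z => WithConv.ofConv T z) Pi.topologicalSpace

/-- The pure tensor `a ⊗ b`, with `(a ⊗ b) (φ ⊗ ψ) = φ a * ψ b`. -/
def tmul (𝕜 : Type) [RCLike 𝕜] {E F : Type u} [AddCommGroup E] [Module 𝕜 E] [TopologicalSpace E]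
    [AddCommGroup F] [Module 𝕜 F] [TopologicalSpace F] (a : E) (b : F) : WTensor 𝕜 E F :=
  WithConv.toConv (formMul (dualEval 𝕜 a) (dualEval 𝕜 b))

lemma ofConv_tmul (a : E) (b : F) (φ : E →L[𝕜] 𝕜) (ψ : F →L[𝕜] 𝕜) :
    WithConv.ofConv (tmul 𝕜 a b) (φ ⊗ₜ ψ) = φ a * ψ b := rfl

lemma continuous_apply (z : (E →L[𝕜] 𝕜) ⊗[𝕜] (F →L[𝕜] 𝕜)) :
    Continuous fun T : WTensor 𝕜 E F => WithConv.ofConv T z :=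
  (_root_.continuous_apply z).comp continuous_induced_dom

lemma continuous_of_apply {X : Type*} [TopologicalSpace X] {f : X → WTensor 𝕜 E F}
    (h : ∀ z, Continuous fun x => WithConv.ofConv (f x) z) : Continuous f :=
  continuous_induced_rng.mpr (continuous_pi h)

end Space

section Algebra

variable {𝕜 : Type} [RCLike 𝕜] {A B : Type u} [Ring A] [Algebra 𝕜 A] [TopologicalSpace A]
  [ContinuousMul A] [WeaklyComplete 𝕜 A] [Ring B] [Algebra 𝕜 B] [TopologicalSpace B]
  [ContinuousMul B] [WeaklyComplete 𝕜 B]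

/-- The ring structure of `A ⊗_W B` is dual to the coalgebra structure of `A' ⊗ B'`; it satisfies
`(a ⊗ b) * (c ⊗ d) = (a * c) ⊗ (b * d)`. -/
instance : Ring (WTensor 𝕜 A B) :=
  inferInstanceAs (Ring (WithConv (((A →L[𝕜] 𝕜) ⊗[𝕜] (B →L[𝕜] 𝕜)) →ₗ[𝕜] 𝕜)))

instance : Algebra 𝕜 (WTensor 𝕜 A B) :=
  inferInstanceAs (Algebra 𝕜 (WithConv (((A →L[𝕜] 𝕜) ⊗[𝕜] (B →L[𝕜] 𝕜)) →ₗ[𝕜] 𝕜)))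

lemma ofConv_mul (S T : WTensor 𝕜 A B) (z : (A →L[𝕜] 𝕜) ⊗[𝕜] (B →L[𝕜] 𝕜)) :
    WithConv.ofConv (S * T) z =
      formMul (WithConv.ofConv S) (WithConv.ofConv T) (Coalgebra.comul (R := 𝕜) z) := rfl

lemma ofConv_add (S T : WTensor 𝕜 A B) : WithConv.ofConv (S + T) =
    WithConv.ofConv S + WithConv.ofConv T := rfl

lemma ofConv_sub (S T : WTensor 𝕜 A B) : WithConv.ofConv (S - T) =
    WithConv.ofConv S - WithConv.ofConv T := rfl

lemma ofConv_smul (c : 𝕜) (T : WTensor 𝕜 A B) : WithConv.ofConv (c • T) =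
    c • WithConv.ofConv T := rfl

lemma tmul_mul_tmul (a c : A) (b d : B) :
    tmul 𝕜 a b * tmul 𝕜 c d = tmul 𝕜 (a * c) (b * d) := by
  apply WithConv.ofConv_injective
  refine TensorProduct.ext' fun φ ψ => ?_
  rw [ofConv_mul, TensorProduct.comul_tmul]
  have h : formMul (formMul (dualEval 𝕜 a) (dualEval 𝕜 b)) (formMul (dualEval 𝕜 c) (dualEval 𝕜 d)) ∘ₗ
      (TensorProduct.AlgebraTensorModule.tensorTensorTensorComm 𝕜 𝕜 𝕜 𝕜 (A →L[𝕜] 𝕜) (A →L[𝕜] 𝕜)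
        (B →L[𝕜] 𝕜) (B →L[𝕜] 𝕜)).toLinearMap =
      formMul (formMul (dualEval 𝕜 a) (dualEval 𝕜 c)) (formMul (dualEval 𝕜 b) (dualEval 𝕜 d)) := by
    refine TensorProduct.ext_fourfold' fun x y z w => ?_
    simp
    ring
  refine (LinearMap.congr_fun h (Coalgebra.comul φ ⊗ₜ Coalgebra.comul ψ)).trans ?_
  rw [formMul_tmul]
  exact congrArg₂ (· * ·) (formMul_dualComul φ a c) (formMul_dualComul ψ b d)

lemma one_eq : (1 : WTensor 𝕜 A B) = tmul 𝕜 1 1 := by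
  apply WithConv.ofConv_injective
  refine TensorProduct.ext' fun φ ψ => ?_
  exact mul_comm (ψ 1) (φ 1)

instance : ContinuousMul (WTensor 𝕜 A B) where
  continuous_mul := by
    refine continuous_of_apply fun z => ?_
    simp only [ofConv_mul]
    generalize (Coalgebra.comul (R := 𝕜) z) = w
    induction w with
    | zero => simpa using continuous_const
    | tmul x y =>
      exact Continuous.mul ((continuous_apply x).comp continuous_fst)
        ((continuous_apply y).comp continuous_snd)
    | add x y hx hy =>
      simp only [map_add]
      exact Continuous.add hx hy

instance : WeaklyComplete 𝕜 (WTensor 𝕜 A B) where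
  exists_equiv := by
    let b := Module.Basis.ofVectorSpace 𝕜 ((A →L[𝕜] 𝕜) ⊗[𝕜] (B →L[𝕜] 𝕜))
    refine ⟨_, ⟨{
      toFun := fun T i => WithConv.ofConv T (b i)
      invFun := fun x => WithConv.toConv (b.constr 𝕜 x)
      map_add' := fun S T => rfl
      map_smul' := fun c T => rfl
      left_inv := fun T => WithConv.ofConv_injective (b.ext fun i => by simp)
      right_inv := fun x => by ext i; simp
      continuous_toFun := continuous_pi fun i => continuous_apply (b i)
      continuous_invFun := continuous_of_apply fun z => ?_ }⟩⟩
    simp only [Module.Basis.constr_apply, Finsupp.sum]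
    refine continuous_finsetSum _ fun i _ => ?_
    fun_prop

end Algebra

end WTensor

/-! ### Profinite-dimensional Lie algebras -/

/-- The closed ideals `I` of a topological Lie algebra `𝔤` with `dim 𝔤 / I < ∞`. -/
def CofiniteIdeal (𝕜 : Type) [RCLike 𝕜] (𝔤 : Type u) [LieRing 𝔤] [LieAlgebra 𝕜 𝔤]
    [TopologicalSpace 𝔤] : Type u :=
  {I : LieIdeal 𝕜 𝔤 // IsClosed (I : Set 𝔤) ∧ FiniteDimensional 𝕜 (𝔤 ⧸ I.toSubmodule)}

/-- The natural map from `𝔤` to the product of all `𝔤 / I`, with `I` in `CofiniteIdeal 𝕜 𝔤`. -/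
def toQuotients (𝕜 : Type) [RCLike 𝕜] (𝔤 : Type u) [LieRing 𝔤] [LieAlgebra 𝕜 𝔤]
    [TopologicalSpace 𝔤] (x : 𝔤) (I : CofiniteIdeal 𝕜 𝔤) : 𝔤 ⧸ I.1.toSubmodule :=
  Submodule.Quotient.mk x

/-- The projective limit of the `𝔤 / I`, a subset of their product. -/
def quotientLimit (𝕜 : Type) [RCLike 𝕜] (𝔤 : Type u) [LieRing 𝔤] [LieAlgebra 𝕜 𝔤]
    [TopologicalSpace 𝔤] : Set (∀ I : CofiniteIdeal 𝕜 𝔤, 𝔤 ⧸ I.1.toSubmodule) :=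
  {s | ∀ (I J : CofiniteIdeal 𝕜 𝔤) (h : J.1.toSubmodule ≤ I.1.toSubmodule),
    Submodule.factor h (s J) = s I}

/-- A topological Lie algebra `𝔤` is profinite-dimensional if the natural map from `𝔤` to the
projective limit of its quotients `𝔤 / I`, for the closed ideals `I` of finite codimension, is an
isomorphism. -/
structure IsProfiniteDimensional (𝕜 : Type) [RCLike 𝕜] (𝔤 : Type u) [LieRing 𝔤] [LieAlgebra 𝕜 𝔤]
    [TopologicalSpace 𝔤] : Prop where
  continuous_lie : Continuous fun p : 𝔤 × 𝔤 => ⁅p.1, p.2⁆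
  isEmbedding : Topology.IsEmbedding (toQuotients 𝕜 𝔤)
  range_eq : Set.range (toQuotients 𝕜 𝔤) = quotientLimit 𝕜 𝔤

/-! ### The weakly complete enveloping algebra and its Hopf algebra structure -/

section Enveloping

variable {𝕜 : Type} [RCLike 𝕜] {𝔤 : Type u} [LieRing 𝔤] [LieAlgebra 𝕜 𝔤] [TopologicalSpace 𝔤]

/-- A continuous linear map from `𝔤` to `A` is a morphism of topological Lie algebras, where `A`
carries the bracket `a * b - b * a`. -/
def IsLieMorphism {A : Type u} [Ring A] [Algebra 𝕜 A] [TopologicalSpace A] (f : 𝔤 →L[𝕜] A) : Prop :=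
  ∀ x y, f ⁅x, y⁆ = f x * f y - f y * f x

/-- The weakly complete unital algebra `U` with `incl : 𝔤 → U` is the weakly complete enveloping
algebra of `𝔤`: every morphism of topological Lie algebras from `𝔤` to a weakly complete unital
algebra `A` extends to a unique morphism of weakly complete unital algebras from `U` to `A`. -/
structure IsWeaklyCompleteEnvelopingAlgebra {U : Type u} [Ring U] [Algebra 𝕜 U]
    [TopologicalSpace U] [ContinuousMul U] [WeaklyComplete 𝕜 U] (incl : 𝔤 →L[𝕜] U) : Prop where
  isLieMorphism : IsLieMorphism incl
  existsUnique_lift : ∀ (A : Type u) [Ring A] [Algebra 𝕜 A] [TopologicalSpace A] [ContinuousMul A]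
    [WeaklyComplete 𝕜 A] (f : 𝔤 →L[𝕜] A), IsLieMorphism f →
      ∃! F : U →A[𝕜] A, ∀ x, F (incl x) = f x

instance weaklyComplete_uLift : WeaklyComplete 𝕜 (ULift.{u} 𝕜) where
  exists_equiv := ⟨PUnit, ⟨ContinuousLinearEquiv.ulift.trans
    (ContinuousLinearEquiv.funUnique PUnit 𝕜 𝕜).symm⟩⟩

instance continuousMul_uLift : ContinuousMul (ULift.{u} 𝕜) where
  continuous_mul := continuous_uliftUp.comp
    ((continuous_uliftDown.comp continuous_fst).mul (continuous_uliftDown.comp continuous_snd))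

namespace IsWeaklyCompleteEnvelopingAlgebra

variable {U : Type u} [Ring U] [Algebra 𝕜 U] [TopologicalSpace U] [ContinuousMul U]
  [WeaklyComplete 𝕜 U] {incl : 𝔤 →L[𝕜] U}

lemma continuous_primitive (incl : 𝔤 →L[𝕜] U) :
    Continuous fun x => WTensor.tmul 𝕜 (incl x) 1 + WTensor.tmul 𝕜 1 (incl x) := by
  refine WTensor.continuous_of_apply fun z => ?_
  simp only [WTensor.ofConv_add, LinearMap.add_apply]
  induction z with
  | zero => simpa using continuous_const
  | tmul φ ψ =>
    simp only [WTensor.ofConv_tmul]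
    fun_prop
  | add z w hz hw =>
    refine (hz.add hw).congr fun x => ?_
    simp only [Pi.add_apply, map_add]
    abel

/-- The morphism `x ↦ x ⊗ 1 + 1 ⊗ x` from `𝔤` to `U ⊗_W U`. -/
def primitiveMap (incl : 𝔤 →L[𝕜] U) : 𝔤 →L[𝕜] WTensor 𝕜 U U where
  toFun x := WTensor.tmul 𝕜 (incl x) 1 + WTensor.tmul 𝕜 1 (incl x)
  map_add' x y := by
    apply WithConv.ofConv_injective
    refine TensorProduct.ext' fun φ ψ => ?_
    simp only [WTensor.ofConv_add, LinearMap.add_apply, WTensor.ofConv_tmul, map_add]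
    ring
  map_smul' c x := by
    apply WithConv.ofConv_injective
    refine TensorProduct.ext' fun φ ψ => ?_
    simp only [WTensor.ofConv_add, WTensor.ofConv_smul, LinearMap.add_apply, LinearMap.smul_apply,
      WTensor.ofConv_tmul, map_smul, RingHom.id_apply, smul_eq_mul]
    ring
  cont := continuous_primitive incl

lemma isLieMorphism_primitiveMap (h : IsLieMorphism incl) : IsLieMorphism (primitiveMap incl) := by
  intro x y
  have h1 : ∀ a b : U, WTensor.tmul 𝕜 (a - b) (1 : U) = WTensor.tmul 𝕜 a 1 - WTensor.tmul 𝕜 b 1 := by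
    intro a b
    apply WithConv.ofConv_injective
    refine TensorProduct.ext' fun φ ψ => ?_
    simp only [WTensor.ofConv_sub, LinearMap.sub_apply, WTensor.ofConv_tmul, map_sub, sub_mul]
  have h2 : ∀ a b : U, WTensor.tmul 𝕜 (1 : U) (a - b) = WTensor.tmul 𝕜 1 a - WTensor.tmul 𝕜 1 b := by
    intro a b
    apply WithConv.ofConv_injective
    refine TensorProduct.ext' fun φ ψ => ?_
    simp only [WTensor.ofConv_sub, LinearMap.sub_apply, WTensor.ofConv_tmul, map_sub, mul_sub]
  change WTensor.tmul 𝕜 (incl ⁅x, y⁆) 1 + WTensor.tmul 𝕜 1 (incl ⁅x, y⁆) =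
    (WTensor.tmul 𝕜 (incl x) 1 + WTensor.tmul 𝕜 1 (incl x)) *
      (WTensor.tmul 𝕜 (incl y) 1 + WTensor.tmul 𝕜 1 (incl y)) -
    (WTensor.tmul 𝕜 (incl y) 1 + WTensor.tmul 𝕜 1 (incl y)) *
      (WTensor.tmul 𝕜 (incl x) 1 + WTensor.tmul 𝕜 1 (incl x))
  simp only [h x y, h1, h2, mul_add, add_mul, WTensor.tmul_mul_tmul, mul_one, one_mul]
  abel

/-- The comultiplication of `U`: the morphism of weakly complete unital algebras from `U` to
`U ⊗_W U` which extends `x ↦ x ⊗ 1 + 1 ⊗ x`. -/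
def comul (h : IsWeaklyCompleteEnvelopingAlgebra incl) : U →A[𝕜] WTensor 𝕜 U U :=
  (h.existsUnique_lift (WTensor 𝕜 U U) (primitiveMap incl)
    (isLieMorphism_primitiveMap h.isLieMorphism)).choose

lemma comul_incl (h : IsWeaklyCompleteEnvelopingAlgebra incl) (x : 𝔤) :
    h.comul (incl x) = WTensor.tmul 𝕜 (incl x) 1 + WTensor.tmul 𝕜 1 (incl x) :=
  (h.existsUnique_lift (WTensor 𝕜 U U) (primitiveMap incl)
    (isLieMorphism_primitiveMap h.isLieMorphism)).choose_spec.1 x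

lemma exists_counit (h : IsWeaklyCompleteEnvelopingAlgebra incl) :
    ∃ k : U →A[𝕜] 𝕜, ∀ x, k (incl x) = 0 := by
  obtain ⟨F, hF, -⟩ := h.existsUnique_lift (ULift.{u} 𝕜) 0 (fun x y => by simp)
  exact ⟨⟨(ULift.algEquiv : ULift.{u} 𝕜 ≃ₐ[𝕜] 𝕜).toAlgHom.comp F.toAlgHom,
    continuous_uliftDown.comp F.cont⟩, fun x => congrArg ULift.down (hF x)⟩

/-- The coidentity of `U`: the morphism of weakly complete unital algebras from `U` to `𝕜` which
vanishes on `𝔤`. -/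
def counit (h : IsWeaklyCompleteEnvelopingAlgebra incl) : U →A[𝕜] 𝕜 :=
  h.exists_counit.choose

lemma counit_incl (h : IsWeaklyCompleteEnvelopingAlgebra incl) (x : 𝔤) : h.counit (incl x) = 0 :=
  h.exists_counit.choose_spec x

/-- Grouplike elements of `U`. -/
def IsGrouplike (h : IsWeaklyCompleteEnvelopingAlgebra incl) (a : U) : Prop :=
  h.comul a = WTensor.tmul 𝕜 a a ∧ h.counit a = 1

end IsWeaklyCompleteEnvelopingAlgebra

end Enveloping

/-- `e = exp y`, the sum of the exponential series in a topological algebra. -/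
def IsExp (𝕜 : Type) [RCLike 𝕜] {A : Type u} [Ring A] [Algebra 𝕜 A] [TopologicalSpace A]
    (y e : A) : Prop :=
  HasSum (fun n : ℕ => ((n.factorial : 𝕜)⁻¹) • y ^ n) e

/-! ### The bialgebra structure of the classical enveloping algebra -/

namespace ClassicalEnveloping

variable (𝕜 : Type) [RCLike 𝕜] (L : Type*) [LieRing L] [LieAlgebra 𝕜 L]

attribute [local instance 100] LieRing.ofAssociativeRing

/-- The Lie algebra morphism `x ↦ x ⊗ 1 + 1 ⊗ x` from `L` to `U(L) ⊗ U(L)`. -/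
def primitiveHom :
    L →ₗ⁅𝕜⁆ UniversalEnvelopingAlgebra 𝕜 L ⊗[𝕜] UniversalEnvelopingAlgebra 𝕜 L where
  toFun x := UniversalEnvelopingAlgebra.ι 𝕜 x ⊗ₜ 1 + 1 ⊗ₜ UniversalEnvelopingAlgebra.ι 𝕜 x
  map_add' x y := by
    rw [map_add, TensorProduct.add_tmul, TensorProduct.tmul_add]
    abel
  map_smul' c x := by
    rw [map_smul, ← TensorProduct.smul_tmul', TensorProduct.tmul_smul, smul_add, RingHom.id_apply]
  map_lie' {x y} := by
    simp only [LieHom.map_lie, LieRing.of_associative_ring_bracket, add_mul, mul_add,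
      Algebra.TensorProduct.tmul_mul_tmul, one_mul, mul_one, TensorProduct.sub_tmul,
      TensorProduct.tmul_sub]
    abel

/-- The comultiplication of `U(L)`, with `x ↦ x ⊗ 1 + 1 ⊗ x` for `x` in `L`. -/
def comul : UniversalEnvelopingAlgebra 𝕜 L →ₐ[𝕜]
    UniversalEnvelopingAlgebra 𝕜 L ⊗[𝕜] UniversalEnvelopingAlgebra 𝕜 L :=
  UniversalEnvelopingAlgebra.lift 𝕜 (primitiveHom 𝕜 L)

/-- The counit of `U(L)`, which vanishes on `L`. -/
def counit : UniversalEnvelopingAlgebra 𝕜 L →ₐ[𝕜] 𝕜 :=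
  UniversalEnvelopingAlgebra.lift 𝕜 0

lemma comul_ι (x : L) : comul 𝕜 L (UniversalEnvelopingAlgebra.ι 𝕜 x) =
    UniversalEnvelopingAlgebra.ι 𝕜 x ⊗ₜ 1 + 1 ⊗ₜ UniversalEnvelopingAlgebra.ι 𝕜 x :=
  UniversalEnvelopingAlgebra.lift_ι_apply 𝕜 _ x

lemma counit_ι (x : L) : counit 𝕜 L (UniversalEnvelopingAlgebra.ι 𝕜 x) = 0 :=
  UniversalEnvelopingAlgebra.lift_ι_apply 𝕜 _ x

lemma hom_ext {B : Type*} [Ring B] [Algebra 𝕜 B] {f g : UniversalEnvelopingAlgebra 𝕜 L →ₐ[𝕜] B}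
    (h : ∀ x, f (UniversalEnvelopingAlgebra.ι 𝕜 x) = g (UniversalEnvelopingAlgebra.ι 𝕜 x)) :
    f = g :=
  UniversalEnvelopingAlgebra.hom_ext 𝕜 (LieHom.ext h)

/-- The bialgebra structure of the enveloping Hopf algebra `U(L)`. -/
instance : Bialgebra 𝕜 (UniversalEnvelopingAlgebra 𝕜 L) :=
  Bialgebra.ofAlgHom (comul 𝕜 L) (counit 𝕜 L)
    (hom_ext 𝕜 L fun x => by
      simp [-UniversalEnvelopingAlgebra.ι_apply, comul_ι, TensorProduct.add_tmul,
        TensorProduct.tmul_add, Algebra.TensorProduct.one_def, add_assoc])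
    (hom_ext 𝕜 L fun x => by simp [-UniversalEnvelopingAlgebra.ι_apply, comul_ι, counit_ι])
    (hom_ext 𝕜 L fun x => by simp [-UniversalEnvelopingAlgebra.ι_apply, comul_ι, counit_ι])

end ClassicalEnveloping

end

/-! Everything on the topological side reduces to finite matrices. Let `φ` be a continuous
functional on a weakly complete algebra `A`. Continuity of multiplication makes `φ (b * a)` a finite
sum of products of functionals of `b` and of `a`, so the translates of `φ` span a finite-dimensional
space, and `φ` is a coefficient of a continuous matrix representation (`exists_matrix_coefficient`).

This has three consequences. Exponential series converge, absolutely under each functional. The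
derivative of `φ (exp (t • y))` at `t = 0` is `φ y`, so `exp (t • y) ≠ 1` for small `t ≠ 0` if `y ≠
0`. And the representations by matrices of size `n`, for natural `n`, detect all weakly complete
algebras: they form a set, and the closed algebra generated by `𝔤` in the product of the matrix
algebras is the enveloping algebra.

An exponential of a primitive element is grouplike since `a ⊗ 1` and `1 ⊗ a` commute, whence `exp (a
⊗ 1 + 1 ⊗ a) = exp a ⊗ exp a`. A grouplike element other than `1` therefore exists once `incl ≠ 0`.
For this a nonzero finite-dimensional quotient of `𝔤` suffices: a linear form if it is abelian, the
adjoint action otherwise.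

In the classical `U(L)`, each element is killed by some power of the ideal of linear forms vanishing
at `1` (`exists_pow_annihilates`). Evaluation at a grouplike `g` is multiplicative for convolution,
so a form vanishing at `1` has a nilpotent value at `g`, that is, the value `0`. Hence `g` is a
multiple of `1`, and the counit gives `g = 1`. -/

noncomputable section

/-! ### Representative functions on weakly complete algebras -/

section MatrixCoefficients

variable {𝕜 : Type} [RCLike 𝕜] {A : Type u} [Ring A] [Algebra 𝕜 A] [TopologicalSpace A]
  [ContinuousMul A]

/-- The left action of `A` on its topological dual by right translation:
`(a • φ) b = φ (b * a)`. -/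
def dualTranslate (𝕜 : Type) [RCLike 𝕜] (A : Type u) [Ring A] [Algebra 𝕜 A] [TopologicalSpace A]
    [ContinuousMul A] : A →ₐ[𝕜] Module.End 𝕜 (A →L[𝕜] 𝕜) :=
  AlgHom.ofLinearMap
    { toFun := fun a =>
        { toFun := fun φ => ⟨(φ : A →ₗ[𝕜] 𝕜) ∘ₗ LinearMap.mulRight 𝕜 a,
            φ.continuous.comp (continuous_id.mul continuous_const)⟩
          map_add' := fun _ _ => rfl
          map_smul' := fun _ _ => rfl }
      map_add' := fun a b => by
        ext φ c
        exact (congrArg φ (mul_add c a b)).trans (map_add φ _ _)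
      map_smul' := fun r a => by
        ext φ c
        exact (congrArg φ (mul_smul_comm r c a)).trans (map_smul φ _ _) }
    (by
      ext φ c
      exact congrArg φ (mul_one c))
    (fun a b => by
      ext φ c
      exact congrArg φ (mul_assoc c a b).symm)

@[simp] lemma dualTranslate_apply (a : A) (φ : A →L[𝕜] 𝕜) (b : A) :
    dualTranslate 𝕜 A a φ b = φ (b * a) := rfl

/-- The comultiplication of `φ` is a finite sum of pure tensors `p.1 ⊗ p.2`. The same finite set
serves for all `a`, so the orbit of `φ` spans a finite-dimensional space. -/
lemma exists_dualTranslate_eq_sum [WeaklyComplete 𝕜 A] (φ : A →L[𝕜] 𝕜) :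
    ∃ S : Finset ((A →L[𝕜] 𝕜) × (A →L[𝕜] 𝕜)), ∀ a,
      dualTranslate 𝕜 A a φ = ∑ p ∈ S, p.2 a • p.1 := by
  obtain ⟨z, hz⟩ := exists_dualComul φ
  obtain ⟨S, rfl⟩ := TensorProduct.exists_finset z
  refine ⟨S, fun a => ?_⟩
  ext b
  rw [dualTranslate_apply, ← hz]
  simp [mul_comm]

/-- Every continuous functional on a weakly complete algebra is a coefficient of a continuous
finite-dimensional representation. -/
lemma exists_matrix_coefficient [WeaklyComplete 𝕜 A] (φ : A →L[𝕜] 𝕜) :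
    ∃ (n : ℕ) (ρ : A →A[𝕜] Matrix (Fin n) (Fin n) 𝕜) (l : Matrix (Fin n) (Fin n) 𝕜 →ₗ[𝕜] 𝕜),
      ∀ a, φ a = l (ρ a) := by
  classical
  let T := dualTranslate 𝕜 A
  let V : Submodule 𝕜 (A →L[𝕜] 𝕜) := LinearMap.range (T.toLinearMap.flip φ)
  have hV : ∀ a, ∀ ψ ∈ V, T a ψ ∈ V := by
    rintro a _ ⟨b, rfl⟩
    exact ⟨a * b, by simp⟩
  have hφ : φ ∈ V := ⟨1, by simp⟩
  have : FiniteDimensional 𝕜 V := by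
    obtain ⟨S, hS⟩ := exists_dualTranslate_eq_sum φ
    have hle : V ≤ Submodule.span 𝕜 (S.image Prod.fst : Set (A →L[𝕜] 𝕜)) := by
      rintro _ ⟨b, rfl⟩
      change T b φ ∈ _
      rw [hS]
      refine Submodule.sum_mem _ fun p hp => Submodule.smul_mem _ _ (Submodule.subset_span ?_)
      exact Finset.mem_coe.mpr (Finset.mem_image_of_mem _ hp)
    have := FiniteDimensional.span_finset 𝕜 (S.image Prod.fst)
    exact Submodule.finiteDimensional_of_le hle
  let R : A →ₐ[𝕜] Module.End 𝕜 V := AlgHom.ofLinearMap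
    { toFun := fun a => (T a).restrict (hV a)
      map_add' := fun a b => by ext; simp
      map_smul' := fun r a => by ext; simp }
    (by ext; simp) (fun a b => by ext; simp)
  have : Module.Free 𝕜 V := Module.Free.of_divisionRing 𝕜 V
  let b := Module.finBasis 𝕜 V
  let ρ : A →ₐ[𝕜] Matrix (Fin (Module.finrank 𝕜 V)) (Fin (Module.finrank 𝕜 V)) 𝕜 :=
    (LinearMap.toMatrixAlgEquiv b).toAlgHom.comp R
  have hρ : Continuous ρ := by
    refine continuous_matrix fun i j => ?_
    -- The terms `p.1` of the translation formula need not lie in `V`. Extending the coordinate to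
    -- the whole dual allows it to be applied to them; the extension needs no continuity, since `a`
    -- enters only through `p.2 a`.
    obtain ⟨μ, hμ⟩ := (b.coord i).exists_extend
    obtain ⟨S, hS⟩ := exists_dualTranslate_eq_sum ((b j : V) : A →L[𝕜] 𝕜)
    have h : ∀ a, ρ a i j = ∑ p ∈ S, p.2 a * μ p.1 := by
      intro a
      have h1 : ρ a i j = b.coord i (R a (b j)) := by
        simp [ρ, LinearMap.toMatrixAlgEquiv_apply]
      rw [h1, ← hμ]
      change μ (T a (b j)) = _
      rw [hS]
      simp
    simp only [h]
    fun_prop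
  -- The coefficient is `M ↦ (M φ) 1`, because `φ a` is the value at `1` of the translate of `φ` by
  -- `a`.
  refine ⟨_, ⟨ρ, hρ⟩, dualEval 𝕜 1 ∘ₗ V.subtype ∘ₗ LinearMap.applyₗ ⟨φ, hφ⟩ ∘ₗ
    (LinearMap.toMatrixAlgEquiv b).symm.toLinearMap, fun a => ?_⟩
  have h : (LinearMap.toMatrixAlgEquiv b).symm (ρ a) = R a :=
    (LinearMap.toMatrixAlgEquiv b).symm_apply_apply (R a)
  change φ a = dualEval 𝕜 1 (((LinearMap.toMatrixAlgEquiv b).symm (ρ a) ⟨φ, hφ⟩ : V) : A →L[𝕜] 𝕜)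
  rw [h]
  change φ a = φ (1 * a)
  rw [one_mul]

end MatrixCoefficients

/-! ### The exponential series -/

section MatrixExponential

open scoped Matrix.Norms.Operator

variable {𝕜 : Type} [RCLike 𝕜] {n : ℕ}

lemma summable_norm_matrix_coefficient_exp (l : Matrix (Fin n) (Fin n) 𝕜 →ₗ[𝕜] 𝕜)
    (Y : Matrix (Fin n) (Fin n) 𝕜) :
    Summable fun k : ℕ => ‖l ((k.factorial : 𝕜)⁻¹ • Y ^ k)‖ := by
  let L : Matrix (Fin n) (Fin n) 𝕜 →L[𝕜] 𝕜 := LinearMap.toContinuousLinearMap l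
  refine Summable.of_nonneg_of_le (fun _ => norm_nonneg _) (fun k => L.le_opNorm _) ?_
  exact (NormedSpace.norm_expSeries_summable' (𝕂 := 𝕜) Y).mul_left _

/-- The function `t ↦ l (exp (t • Y))` has derivative `l Y ≠ 0` at `0`, so near `0` it takes its
value `l 1` only at `0`. -/
lemma eventually_not_hasSum_matrix_coefficient_exp (l : Matrix (Fin n) (Fin n) 𝕜 →ₗ[𝕜] 𝕜)
    (Y : Matrix (Fin n) (Fin n) 𝕜) (hY : l Y ≠ 0) :
    ∀ᶠ t in 𝓝[≠] (0 : 𝕜),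
      ¬ HasSum (fun k : ℕ => l ((k.factorial : 𝕜)⁻¹ • (t • Y) ^ k)) (l 1) := by
  let L : Matrix (Fin n) (Fin n) 𝕜 →L[𝕜] 𝕜 := LinearMap.toContinuousLinearMap l
  have h1 : HasDerivAt (fun t : 𝕜 => L (NormedSpace.exp (t • Y))) (L Y) 0 := by
    have := hasDerivAt_exp_smul_const (𝕂 := 𝕜) Y (0 : 𝕜)
    simp only [zero_smul, NormedSpace.exp_zero, one_mul] at this
    exact L.hasFDerivAt.comp_hasDerivAt _ this
  filter_upwards [h1.eventually_ne (c := l 1) hY] with t ht hs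
  have h2 := L.hasSum (NormedSpace.exp_series_hasSum_exp' (𝕂 := 𝕜) (t • Y))
  exact ht (h2.unique hs)

end MatrixExponential

section Exponential

variable {𝕜 : Type} [RCLike 𝕜] {A : Type u} [Ring A] [Algebra 𝕜 A] [TopologicalSpace A]

lemma WeaklyComplete.t2Space (𝕜 : Type) [RCLike 𝕜] (E : Type u) [AddCommGroup E] [Module 𝕜 E]
    [TopologicalSpace E] [WeaklyComplete 𝕜 E] : T2Space E := by
  obtain ⟨J, ⟨e⟩⟩ := WeaklyComplete.exists_equiv (𝕜 := 𝕜) (E := E)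
  exact e.toHomeomorph.isEmbedding.t2Space

lemma WeaklyComplete.exists_apply_ne_zero {E : Type u} [AddCommGroup E] [Module 𝕜 E]
    [TopologicalSpace E] [WeaklyComplete 𝕜 E] {x : E} (hx : x ≠ 0) : ∃ φ : E →L[𝕜] 𝕜, φ x ≠ 0 := by
  obtain ⟨J, ⟨e⟩⟩ := WeaklyComplete.exists_equiv (𝕜 := 𝕜) (E := E)
  have h : e x ≠ 0 := by simpa using hx
  obtain ⟨j, hj⟩ := Function.ne_iff.mp h
  exact ⟨(ContinuousLinearMap.proj j).comp (e : E →L[𝕜] (J → 𝕜)), hj⟩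

variable [ContinuousMul A] [WeaklyComplete 𝕜 A]

lemma summable_norm_apply_exp (φ : A →L[𝕜] 𝕜) (y : A) :
    Summable fun n : ℕ => ‖φ ((n.factorial : 𝕜)⁻¹ • y ^ n)‖ := by
  obtain ⟨n, ρ, l, h⟩ := exists_matrix_coefficient φ
  simpa only [h, map_smul, map_pow] using summable_norm_matrix_coefficient_exp l (ρ y)

/-- Convergence in `𝕜 ^ J` is coordinatewise, and each coordinate is a continuous functional, hence
a matrix coefficient. -/
lemma exists_isExp (y : A) : ∃ e, IsExp 𝕜 y e := by
  obtain ⟨J, ⟨E⟩⟩ := WeaklyComplete.exists_equiv (𝕜 := 𝕜) (E := A)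
  have h : HasSum (fun n : ℕ => E ((n.factorial : 𝕜)⁻¹ • y ^ n))
      (fun j => ∑' n : ℕ, E ((n.factorial : 𝕜)⁻¹ • y ^ n) j) :=
    Pi.hasSum.mpr fun j => (summable_norm_apply_exp
      ((ContinuousLinearMap.proj j).comp (E : A →L[𝕜] (J → 𝕜))) y).of_norm.hasSum
  have h2 := (E.symm : (J → 𝕜) →L[𝕜] A).hasSum h
  exact ⟨_, by simpa [IsExp, Function.comp_def] using h2⟩

lemma eventually_exp_ne_one {y : A} (hy : y ≠ 0) :
    ∀ᶠ t in 𝓝[≠] (0 : 𝕜), ¬ IsExp 𝕜 (t • y) 1 := by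
  obtain ⟨φ, hφ⟩ := WeaklyComplete.exists_apply_ne_zero (𝕜 := 𝕜) hy
  obtain ⟨n, ρ, l, h⟩ := exists_matrix_coefficient φ
  filter_upwards [eventually_not_hasSum_matrix_coefficient_exp l (ρ y) (by rwa [← h])] with t ht he
  refine ht ?_
  simpa only [Function.comp_def, h, map_smul, map_pow, map_one] using φ.hasSum he

end Exponential

namespace WTensor

variable {𝕜 : Type} [RCLike 𝕜] {A B : Type u} [Ring A] [Algebra 𝕜 A] [TopologicalSpace A]
  [ContinuousMul A] [WeaklyComplete 𝕜 A] [Ring B] [Algebra 𝕜 B] [TopologicalSpace B]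
  [ContinuousMul B] [WeaklyComplete 𝕜 B]

/-- Evaluation of the elements of `A ⊗_W B` at an element of `A' ⊗ B'`. -/
def evalCLM (z : (A →L[𝕜] 𝕜) ⊗[𝕜] (B →L[𝕜] 𝕜)) : WTensor 𝕜 A B →L[𝕜] 𝕜 where
  toFun T := WithConv.ofConv T z
  map_add' _ _ := rfl
  map_smul' _ _ := rfl
  cont := continuous_apply z

lemma evalCLM_tmul (a : A) (b : B) (φ : A →L[𝕜] 𝕜) (ψ : B →L[𝕜] 𝕜) :
    evalCLM (φ ⊗ₜ ψ) (tmul 𝕜 a b) = φ a * ψ b := rfl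

lemma ext_evalCLM {S T : WTensor 𝕜 A B}
    (h : ∀ (φ : A →L[𝕜] 𝕜) (ψ : B →L[𝕜] 𝕜), evalCLM (φ ⊗ₜ ψ) S = evalCLM (φ ⊗ₜ ψ) T) : S = T :=
  WithConv.ofConv_injective (TensorProduct.ext' h)

lemma tmul_one_pow (a : A) (n : ℕ) : tmul 𝕜 a (1 : B) ^ n = tmul 𝕜 (a ^ n) 1 := by
  induction n with
  | zero => simp [one_eq]
  | succ n ih => rw [pow_succ, ih, tmul_mul_tmul, pow_succ, one_mul]

lemma one_tmul_pow (b : B) (n : ℕ) : tmul 𝕜 (1 : A) b ^ n = tmul 𝕜 1 (b ^ n) := by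
  induction n with
  | zero => simp [one_eq]
  | succ n ih => rw [pow_succ, ih, tmul_mul_tmul, pow_succ, one_mul]

/-- By the binomial theorem for commuting elements, the `n`-th term of the exponential series
becomes the `n`-th term of a Cauchy product of scalar series. -/
lemma evalCLM_exp_term (a : A) (b : B) (φ : A →L[𝕜] 𝕜) (ψ : B →L[𝕜] 𝕜) (n : ℕ) :
    evalCLM (φ ⊗ₜ ψ) ((n.factorial : 𝕜)⁻¹ • (tmul 𝕜 a 1 + tmul 𝕜 1 b) ^ n) =
      ∑ p ∈ Finset.HasAntidiagonal.antidiagonal n,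
        φ ((p.1.factorial : 𝕜)⁻¹ • a ^ p.1) * ψ ((p.2.factorial : 𝕜)⁻¹ • b ^ p.2) := by
  have hc : Commute (tmul 𝕜 a (1 : B)) (tmul 𝕜 (1 : A) b) := by
    simp [Commute, SemiconjBy, tmul_mul_tmul]
  rw [hc.add_pow', map_smul, map_sum, smul_eq_mul, Finset.mul_sum]
  refine Finset.sum_congr rfl fun p hp => ?_
  rw [map_nsmul, tmul_one_pow, one_tmul_pow, tmul_mul_tmul, one_mul, mul_one, evalCLM_tmul]
  rw [Finset.HasAntidiagonal.mem_antidiagonal] at hp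
  have h := congrArg (Nat.cast (R := 𝕜)) (Nat.add_choose_mul_factorial_mul_factorial p.1 p.2)
  rw [hp] at h
  push_cast at h
  simp only [map_smul, smul_eq_mul, nsmul_eq_mul]
  have h0 : ∀ m : ℕ, (m.factorial : 𝕜) ≠ 0 := fun m => Nat.cast_ne_zero.mpr m.factorial_ne_zero
  field_simp [h0]
  rw [← h, Nat.choose_symm_of_eq_add hp.symm]
  ring

/-- In `A ⊗_W B` one has `exp (a ⊗ 1 + 1 ⊗ b) = exp a ⊗ exp b`. -/
lemma eq_tmul_of_isExp {a e : A} {b f : B} (ha : IsExp 𝕜 a e) (hb : IsExp 𝕜 b f)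
    {T : WTensor 𝕜 A B} (hT : IsExp 𝕜 (tmul 𝕜 a 1 + tmul 𝕜 1 b) T) : T = tmul 𝕜 e f := by
  refine ext_evalCLM fun φ ψ => ?_
  have h := (evalCLM (φ ⊗ₜ ψ)).hasSum hT
  simp only [evalCLM_exp_term] at h
  rw [evalCLM_tmul, ← h.tsum_eq, ← (φ.hasSum ha).tsum_eq, ← (ψ.hasSum hb).tsum_eq]
  -- The Cauchy product formula needs absolute convergence, which holds after applying `φ` and `ψ`.
  exact (tsum_mul_tsum_eq_tsum_sum_antidiagonal_of_summable_norm
    (summable_norm_apply_exp φ a) (summable_norm_apply_exp ψ b)).symm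

end WTensor

lemma IsExp.map {𝕜 : Type} [RCLike 𝕜] {A B : Type*} [Ring A] [Algebra 𝕜 A] [TopologicalSpace A]
    [Ring B] [Algebra 𝕜 B] [TopologicalSpace B] {y e : A} (h : IsExp 𝕜 y e) (F : A →A[𝕜] B) :
    IsExp 𝕜 (F y) (F e) := by
  have := HasSum.map h F F.cont
  unfold IsExp
  simpa only [Function.comp_def, map_smul, map_pow] using this

lemma isExp_zero (𝕜 : Type) [RCLike 𝕜] (A : Type*) [Ring A] [Algebra 𝕜 A] [TopologicalSpace A] :
    IsExp 𝕜 (0 : A) 1 := by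
  have := hasSum_single (f := fun n : ℕ => ((n.factorial : 𝕜)⁻¹) • (0 : A) ^ n) 0
    (fun n hn => by simp [hn])
  unfold IsExp
  simpa using this

/-- Continuous algebra morphisms commute with exponentials, so the comultiplication and the counit
need only be known on `incl x`. -/
lemma IsWeaklyCompleteEnvelopingAlgebra.isGrouplike_of_isExp {𝕜 : Type} [RCLike 𝕜] {𝔤 : Type u}
    [LieRing 𝔤] [LieAlgebra 𝕜 𝔤] [TopologicalSpace 𝔤] {U : Type u} [Ring U] [Algebra 𝕜 U]
    [TopologicalSpace U] [ContinuousMul U] [WeaklyComplete 𝕜 U] {incl : 𝔤 →L[𝕜] U}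
    (hU : IsWeaklyCompleteEnvelopingAlgebra incl) {x : 𝔤} {e : U} (he : IsExp 𝕜 (incl x) e) :
    hU.IsGrouplike e := by
  refine ⟨WTensor.eq_tmul_of_isExp he he ?_, ?_⟩
  · rw [← hU.comul_incl]
    exact he.map hU.comul
  · have h := he.map hU.counit
    rw [hU.counit_incl] at h
    exact h.unique (isExp_zero 𝕜 𝕜)

/-! ### Grouplike elements of the classical enveloping algebra -/

namespace ClassicalEnveloping

variable {𝕜 : Type} [RCLike 𝕜] {L : Type*} [LieRing L] [LieAlgebra 𝕜 L]

lemma eq_top_of_ι_mem (N : Subalgebra 𝕜 (UniversalEnvelopingAlgebra 𝕜 L))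
    (h : ∀ x, UniversalEnvelopingAlgebra.ι 𝕜 x ∈ N) : N = ⊤ := by
  have h1 : N.comap (UniversalEnvelopingAlgebra.mkAlgHom 𝕜 L) = ⊤ := by
    rw [eq_top_iff, ← TensorAlgebra.adjoin_range_ι, Algebra.adjoin_le_iff]
    rintro _ ⟨x, rfl⟩
    exact h x
  rw [eq_top_iff]
  rintro a -
  obtain ⟨t, rfl⟩ : ∃ t, UniversalEnvelopingAlgebra.mkAlgHom 𝕜 L t = a :=
    RingCon.mkₐ_surjective (α := 𝕜) (UniversalEnvelopingAlgebra.ringCon 𝕜 L) a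
  have ht : t ∈ N.comap (UniversalEnvelopingAlgebra.mkAlgHom 𝕜 L) := h1 ▸ Algebra.mem_top
  exact ht

variable (𝕜 L) in
/-- The convolution algebra of linear forms on `U(L)`. -/
abbrev ConvDual := WithConv (UniversalEnvelopingAlgebra 𝕜 L →ₗ[𝕜] 𝕜)

/-- The transpose of the multiplication from the left by `x` in `L`. -/
def translate (x : L) (f : ConvDual 𝕜 L) : ConvDual 𝕜 L :=
  WithConv.toConv (f.ofConv ∘ₗ LinearMap.mulLeft 𝕜 (UniversalEnvelopingAlgebra.ι 𝕜 x))

lemma translate_apply (x : L) (f : ConvDual 𝕜 L) (u : UniversalEnvelopingAlgebra 𝕜 L) :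
    (translate x f).ofConv u = f.ofConv (UniversalEnvelopingAlgebra.ι 𝕜 x * u) := rfl

lemma translate_add (x : L) (f g : ConvDual 𝕜 L) :
    translate x (f + g) = translate x f + translate x g := rfl

/-- Dual to the primitivity of `x`: multiplication by `x` on `U(L)` transposes to a derivation of
the convolution algebra. -/
lemma translate_mul (x : L) (f g : ConvDual 𝕜 L) :
    translate x (f * g) = translate x f * g + f * translate x g := by
  apply WithConv.ofConv_injective
  ext u
  have hx : Coalgebra.comul (R := 𝕜) (UniversalEnvelopingAlgebra.ι 𝕜 x * u) =
      (UniversalEnvelopingAlgebra.ι 𝕜 x ⊗ₜ 1 + 1 ⊗ₜ UniversalEnvelopingAlgebra.ι 𝕜 x) *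
        Coalgebra.comul (R := 𝕜) u := by
    rw [Bialgebra.comul_mul]
    exact congrArg (· * _) (comul_ι 𝕜 L x)
  rw [translate_apply, WithConv.ofConv_add, LinearMap.add_apply, LinearMap.convMul_apply,
    LinearMap.convMul_apply, LinearMap.convMul_apply, hx]
  generalize Coalgebra.comul (R := 𝕜) u = z
  induction z with
  | zero => simp
  | tmul a b =>
    simp [add_mul, Algebra.TensorProduct.tmul_mul_tmul, translate_apply,
      -UniversalEnvelopingAlgebra.ι_apply]
  | add y z hy hz =>
    simp only [mul_add, map_add, hy, hz]
    ring

variable (𝕜 L) in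
/-- Evaluation at `1`, a character of the convolution algebra. -/
def evalOne : ConvDual 𝕜 L →+* 𝕜 where
  toFun f := f.ofConv 1
  map_one' := by simp
  map_zero' := rfl
  map_add' _ _ := rfl
  map_mul' f g := by simp [Algebra.TensorProduct.one_def]

/-- A derivation lowers the order of vanishing by at most one, by the Leibniz rule. -/
lemma translate_mem_pow (x : L) (m : ℕ) {f : ConvDual 𝕜 L}
    (hf : f ∈ RingHom.ker (evalOne 𝕜 L) ^ (m + 1)) :
    translate x f ∈ RingHom.ker (evalOne 𝕜 L) ^ m := by
  induction m generalizing f with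
  | zero =>
    rw [Submodule.pow_zero, Ideal.one_eq_top]
    exact Submodule.mem_top
  | succ m ih =>
    rw [Ideal.IsTwoSided.pow_succ] at hf
    refine Submodule.smul_induction_on (p := fun f => translate x f ∈ _) hf
      (fun f hf g hg => ?_) (fun f g hf hg => ?_)
    · rw [smul_eq_mul, translate_mul]
      refine add_mem (Ideal.mul_mem_left _ _ hg) ?_
      rw [Ideal.IsTwoSided.pow_succ]
      exact Ideal.mul_mem_mul hf (ih hg)
    · rw [translate_add]
      exact add_mem hf hg

/-- Every element of `U(L)` is annihilated by a power of the augmentation ideal of the convolution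
algebra. -/
lemma exists_pow_annihilates (u : UniversalEnvelopingAlgebra 𝕜 L) :
    ∃ k : ℕ, ∀ f ∈ RingHom.ker (evalOne 𝕜 L) ^ (k + 1), f.ofConv u = 0 := by
  have mono : ∀ {k l : ℕ}, k ≤ l →
      RingHom.ker (evalOne 𝕜 L) ^ (l + 1) ≤ RingHom.ker (evalOne 𝕜 L) ^ (k + 1) :=
    fun h => Ideal.pow_le_pow_right (Nat.succ_le_succ h)
  let S : Submodule 𝕜 (UniversalEnvelopingAlgebra 𝕜 L) :=
    { carrier := {u | ∃ k : ℕ, ∀ f ∈ RingHom.ker (evalOne 𝕜 L) ^ (k + 1), f.ofConv u = 0}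
      zero_mem' := ⟨0, fun f _ => map_zero _⟩
      add_mem' := by
        rintro a b ⟨k, hk⟩ ⟨l, hl⟩
        refine ⟨max k l, fun f hf => ?_⟩
        rw [map_add, hk f (mono (le_max_left k l) hf), hl f (mono (le_max_right k l) hf), add_zero]
      smul_mem' := by
        rintro c a ⟨k, hk⟩
        exact ⟨k, fun f hf => by rw [map_smul, hk f hf, smul_zero]⟩ }
  -- The subspace `S` is not visibly closed under products, but its left stabilizer `N` is a
  -- subalgebra. It suffices that `N` contains `L` and that `1 ∈ S`.
  let N : Subalgebra 𝕜 (UniversalEnvelopingAlgebra 𝕜 L) :=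
    { carrier := {a | ∀ v ∈ S, a * v ∈ S}
      mul_mem' := fun {a b} ha hb v hv => by
        rw [mul_assoc]
        exact ha _ (hb v hv)
      add_mem' := fun {a b} ha hb v hv => by
        rw [add_mul]
        exact add_mem (ha v hv) (hb v hv)
      algebraMap_mem' := fun c v hv => by
        rw [← Algebra.smul_def]
        exact S.smul_mem c hv }
  have hN : N = ⊤ := by
    refine eq_top_of_ι_mem N fun x v hv => ?_
    obtain ⟨k, hk⟩ := hv
    -- Multiplying by one more element of `L` costs one more power of the ideal.
    exact ⟨k + 1, fun f hf => hk _ (translate_mem_pow x (k + 1) hf)⟩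
  have h1 : (1 : UniversalEnvelopingAlgebra 𝕜 L) ∈ S :=
    ⟨0, fun f hf => by rwa [zero_add, Submodule.pow_one] at hf⟩
  have hu : u ∈ N := hN ▸ Algebra.mem_top
  have := hu 1 h1
  rwa [mul_one] at this

lemma pow_apply_of_isGroupLikeElem {g : UniversalEnvelopingAlgebra 𝕜 L} (hg : IsGroupLikeElem 𝕜 g)
    (f : ConvDual 𝕜 L) (m : ℕ) : (f ^ m).ofConv g = f.ofConv g ^ m := by
  induction m with
  | zero => simp [hg.counit_eq_one]
  | succ m ih =>
    rw [pow_succ, pow_succ, LinearMap.convMul_apply, hg.comul_eq_tmul_self, TensorProduct.map_tmul,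
      LinearMap.mul'_apply, ih]

lemma isGroupLikeElem_iff (g : UniversalEnvelopingAlgebra 𝕜 L) : IsGroupLikeElem 𝕜 g ↔ g = 1 := by
  constructor
  · intro hg
    have key : ∀ f : ConvDual 𝕜 L, f.ofConv 1 = 0 → f.ofConv g = 0 := by
      intro f hf
      obtain ⟨k, hk⟩ := exists_pow_annihilates g
      have := hk (f ^ (k + 1)) (Ideal.pow_mem_pow hf _)
      rw [pow_apply_of_isGroupLikeElem hg] at this
      exact eq_zero_of_pow_eq_zero this
    rw [← sub_eq_zero, ← Module.forall_dual_apply_eq_zero_iff 𝕜]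
    intro h
    -- Subtracting `h 1` times the counit makes `h` vanish at `1`. Since the counit is `1` at `g`,
    -- the conclusion is `h g = h 1`.
    have := key (WithConv.toConv (h - h 1 • Coalgebra.counit (R := 𝕜))) (by simp)
    simpa [hg.counit_eq_one] using this
  · rintro rfl
    exact ⟨by simp, by simp [Algebra.TensorProduct.one_def]⟩

end ClassicalEnveloping

/-! ### Closed subspaces of weakly complete spaces -/

/-- A closed subspace of `𝕜 ^ J` is determined by the linear relations between finitely many
coordinates which hold on it. -/
lemma mem_of_forall_finite_relation {𝕜 : Type} [RCLike 𝕜] {J : Type*} {W : Submodule 𝕜 (J → 𝕜)}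
    (hW : IsClosed (W : Set (J → 𝕜))) {w : J → 𝕜}
    (h : ∀ (S : Finset J) (f : (S → 𝕜) →ₗ[𝕜] 𝕜), (∀ v ∈ W, f (fun i => v i) = 0) →
      f (fun i => w i) = 0) : w ∈ W := by
  rw [← SetLike.mem_coe, ← hW.closure_eq, mem_closure_iff]
  intro o ho hwo
  obtain ⟨S, t, ht, hSt⟩ := isOpen_pi_iff.mp ho w hwo
  let r : (J → 𝕜) →ₗ[𝕜] (S → 𝕜) := LinearMap.funLeft 𝕜 𝕜 Subtype.val
  -- A basic neighbourhood of `w` restricts only the coordinates in `S`. In the finite power `𝕜 ^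
  -- S`, a point outside the image of `W` would be separated from it by a linear form, that is, by a
  -- violated relation.
  have hr : r w ∈ W.map r := by
    by_contra hn
    obtain ⟨f, hf, hfW⟩ := Submodule.exists_le_ker_of_notMem hn
    exact hf (h S f fun v hv => hfW (Submodule.mem_map_of_mem hv))
  obtain ⟨v, hv, hvw⟩ := hr
  refine ⟨v, hSt fun i hi => ?_, hv⟩
  have : v i = w i := congrFun hvw ⟨i, hi⟩
  rw [this]
  exact (ht i hi).2

/-- The algebraic dual of a vector space, with the topology of pointwise convergence, is weakly
complete. -/
lemma WeaklyComplete.of_linearEquiv_dual {𝕜 : Type} [RCLike 𝕜] {E : Type u} [AddCommGroup E]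
    [Module 𝕜 E] [TopologicalSpace E] {P : Type u} [AddCommGroup P] [Module 𝕜 P]
    (T : E ≃ₗ[𝕜] Module.Dual 𝕜 P) (hT : Topology.IsInducing fun w (q : P) => T w q) :
    WeaklyComplete 𝕜 E := by
  let b := Module.Basis.ofVectorSpace 𝕜 P
  refine ⟨_, ⟨⟨T.trans (b.constr 𝕜).symm, ?_, ?_⟩⟩⟩
  · exact continuous_pi fun i => (continuous_apply (b i)).comp hT.continuous
  · refine hT.continuous_iff.mpr (continuous_pi fun q => ?_)
    have h : ∀ x, T ((T.trans (b.constr 𝕜).symm).symm x) q = b.constr 𝕜 x q := fun x =>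
      LinearMap.congr_fun (T.apply_symm_apply (b.constr 𝕜 x)) q
    refine Continuous.congr ?_ fun x => (h x).symm
    simp only [Module.Basis.constr_apply, Finsupp.sum]
    refine continuous_finsetSum _ fun i _ => ?_
    fun_prop

/-- `W` is the algebraic dual of the span `P` of its coordinate forms. Given `g` on `P`, the point
with coordinates `g (p j)` satisfies every finite relation valid on `W`, since such a relation is an
identity in `P`; closedness then puts it in `W`. -/
lemma WeaklyComplete.of_isClosed_pi {𝕜 : Type} [RCLike 𝕜] {J : Type u} (W : Submodule 𝕜 (J → 𝕜))
    (hW : IsClosed (W : Set (J → 𝕜))) : WeaklyComplete 𝕜 W := by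
  classical
  let p : J → Module.Dual 𝕜 W := fun j => LinearMap.proj j ∘ₗ W.subtype
  let P : Submodule 𝕜 (Module.Dual 𝕜 W) := Submodule.span 𝕜 (Set.range p)
  have hp : ∀ j, p j ∈ P := fun j => Submodule.subset_span ⟨j, rfl⟩
  have hP : ∀ q ∈ P, Continuous q := by
    intro q hq
    induction hq using Submodule.span_induction with
    | mem q hq =>
      obtain ⟨j, rfl⟩ := hq
      exact (continuous_apply j).comp continuous_subtype_val
    | zero => exact continuous_const
    | add q r _ _ hq hr => exact hq.add hr
    | smul c q _ hq => exact continuous_const.mul hq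
  have hmem : ∀ g : P →ₗ[𝕜] 𝕜, (fun j => g ⟨p j, hp j⟩) ∈ W := by
    refine fun g => mem_of_forall_finite_relation hW fun S f hf => ?_
    have h0 : ∑ i : S, f (fun j => if i = j then 1 else 0) • (⟨p i, hp i⟩ : P) = 0 := by
      apply Subtype.ext
      refine LinearMap.ext fun v => ?_
      have := hf v v.2
      rw [LinearMap.pi_apply_eq_sum_univ] at this
      rw [← Submodule.subtype_apply, map_sum, LinearMap.sum_apply]
      refine Eq.trans (Finset.sum_congr rfl fun i _ => ?_) this
      exact mul_comm _ _
    have h1 := congrArg g h0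
    rw [map_sum, map_zero] at h1
    rw [LinearMap.pi_apply_eq_sum_univ]
    refine Eq.trans (Finset.sum_congr rfl fun i _ => ?_) h1
    rw [map_smul, smul_eq_mul, smul_eq_mul, mul_comm]
  let T₀ : W →ₗ[𝕜] Module.Dual 𝕜 P := P.subtype.flip
  have hT₀ : Function.Bijective T₀ := by
    refine ⟨fun v w h => Subtype.ext (funext fun j => LinearMap.congr_fun h ⟨p j, hp j⟩),
      fun g => ⟨⟨_, hmem g⟩, LinearMap.ext ?_⟩⟩
    rintro ⟨q, hq⟩
    induction hq using Submodule.span_induction with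
    | mem q hq =>
      obtain ⟨j, rfl⟩ := hq
      rfl
    | zero => exact (map_zero g).symm
    | add q r hq' hr' hq hr =>
      exact (congrArg₂ (· + ·) hq hr).trans (map_add g ⟨q, hq'⟩ ⟨r, hr'⟩).symm
    | smul c q hq' hq => exact (congrArg (c * ·) hq).trans (map_smul g c ⟨q, hq'⟩).symm
  refine WeaklyComplete.of_linearEquiv_dual (P := P) (LinearEquiv.ofBijective T₀ hT₀) ?_
  refine Topology.IsInducing.of_comp (g := fun (x : P → 𝕜) j => x ⟨p j, hp j⟩)
    (continuous_pi fun q => hP q q.2) (continuous_pi fun j => continuous_apply _) ?_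
  exact Topology.IsInducing.subtypeVal

lemma WeaklyComplete.of_equiv {𝕜 : Type} [RCLike 𝕜] {E F : Type u} [AddCommGroup E] [Module 𝕜 E]
    [TopologicalSpace E] [AddCommGroup F] [Module 𝕜 F] [TopologicalSpace F] [WeaklyComplete 𝕜 F]
    (e : E ≃L[𝕜] F) : WeaklyComplete 𝕜 E := by
  obtain ⟨J, ⟨e'⟩⟩ := WeaklyComplete.exists_equiv (𝕜 := 𝕜) (E := F)
  exact ⟨J, ⟨e.trans e'⟩⟩

lemma WeaklyComplete.of_isClosed {𝕜 : Type} [RCLike 𝕜] {E : Type u} [AddCommGroup E] [Module 𝕜 E]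
    [TopologicalSpace E] [WeaklyComplete 𝕜 E] (W : Submodule 𝕜 E) (hW : IsClosed (W : Set E)) :
    WeaklyComplete 𝕜 W := by
  obtain ⟨J, ⟨e⟩⟩ := WeaklyComplete.exists_equiv (𝕜 := 𝕜) (E := E)
  have hW' : IsClosed (W.map (e : E →ₗ[𝕜] (J → 𝕜)) : Set (J → 𝕜)) :=
    e.toHomeomorph.isClosedMap _ hW
  have := WeaklyComplete.of_isClosed_pi _ hW'
  exact WeaklyComplete.of_equiv (e.submoduleMap W)

/-! ### Existence of the weakly complete enveloping algebra -/

section Existence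

/-- The continuous finite-dimensional representations of `𝔤` by matrices. -/
def MatrixRep (𝕜 : Type) [RCLike 𝕜] (𝔤 : Type u) [LieRing 𝔤] [LieAlgebra 𝕜 𝔤]
    [TopologicalSpace 𝔤] : Type u :=
  Σ n : ℕ, {f : 𝔤 →L[𝕜] Matrix (Fin n) (Fin n) 𝕜 // ∀ x y, f ⁅x, y⁆ = f x * f y - f y * f x}

variable (𝕜 : Type) [RCLike 𝕜] (𝔤 : Type u) [LieRing 𝔤] [LieAlgebra 𝕜 𝔤] [TopologicalSpace 𝔤]

/-- The product of the matrix algebras over all continuous finite-dimensional representations. -/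
abbrev MatrixProduct : Type u := ∀ i : MatrixRep 𝕜 𝔤, Matrix (Fin i.1) (Fin i.1) 𝕜

instance weaklyComplete_matrixProduct : WeaklyComplete 𝕜 (MatrixProduct 𝕜 𝔤) where
  exists_equiv := ⟨Σ i : MatrixRep 𝕜 𝔤, Fin i.1 × Fin i.1, ⟨{
    toFun := fun p k => p k.1 k.2.1 k.2.2
    invFun := fun x i => Matrix.of fun a b => x ⟨i, a, b⟩
    map_add' := fun _ _ => rfl
    map_smul' := fun _ _ => rfl
    left_inv := fun _ => rfl
    right_inv := fun _ => rfl
    continuous_toFun := continuous_pi fun k =>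
      Continuous.matrix_elem (continuous_apply k.1) k.2.1 k.2.2
    continuous_invFun := continuous_pi fun _ => continuous_matrix fun _ _ => continuous_apply _ }⟩⟩

/-- The universal representation of `𝔤`, the product of all of them. -/
def universalRep : 𝔤 →L[𝕜] MatrixProduct 𝕜 𝔤 := ContinuousLinearMap.pi fun i => i.2.1

/-- The closed algebra generated by the image of the universal representation. -/
def envelope : Subalgebra 𝕜 (MatrixProduct 𝕜 𝔤) :=
  (FreeAlgebra.lift 𝕜 (universalRep 𝕜 𝔤)).range.topologicalClosure

instance continuousMul_envelope : ContinuousMul (envelope 𝕜 𝔤) where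
  continuous_mul := ((continuous_subtype_val.comp continuous_fst).mul
    (continuous_subtype_val.comp continuous_snd)).subtype_mk _

instance weaklyComplete_envelope : WeaklyComplete 𝕜 (envelope 𝕜 𝔤) :=
  WeaklyComplete.of_isClosed (Subalgebra.toSubmodule (envelope 𝕜 𝔤))
    (Subalgebra.isClosed_topologicalClosure _)

/-- The inclusion of `𝔤` into its envelope. -/
def envelopeIncl : 𝔤 →L[𝕜] envelope 𝕜 𝔤 :=
  (universalRep 𝕜 𝔤).codRestrict (Subalgebra.toSubmodule (envelope 𝕜 𝔤)) fun x =>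
    Subalgebra.le_topologicalClosure _ ⟨FreeAlgebra.ι 𝕜 x, FreeAlgebra.lift_ι_apply _ _⟩

lemma coe_envelopeIncl (x : 𝔤) : (envelopeIncl 𝕜 𝔤 x : MatrixProduct 𝕜 𝔤) = universalRep 𝕜 𝔤 x :=
  rfl

lemma coe_lift_envelopeIncl (t : FreeAlgebra 𝕜 𝔤) :
    (FreeAlgebra.lift 𝕜 (envelopeIncl 𝕜 𝔤) t : MatrixProduct 𝕜 𝔤) =
      FreeAlgebra.lift 𝕜 (universalRep 𝕜 𝔤) t := by
  have h : (envelope 𝕜 𝔤).val.comp (FreeAlgebra.lift 𝕜 (envelopeIncl 𝕜 𝔤)) =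
      FreeAlgebra.lift 𝕜 (universalRep 𝕜 𝔤) := by
    ext x : 2
    simp [coe_envelopeIncl]
  exact DFunLike.congr_fun h t

lemma denseRange_lift_envelopeIncl : DenseRange (FreeAlgebra.lift 𝕜 (envelopeIncl 𝕜 𝔤)) := by
  intro u
  rw [closure_subtype, ← Set.range_comp]
  have h : (Subtype.val ∘ FreeAlgebra.lift 𝕜 (envelopeIncl 𝕜 𝔤)) =
      FreeAlgebra.lift 𝕜 (universalRep 𝕜 𝔤) := funext (coe_lift_envelopeIncl 𝕜 𝔤)
  rw [h]
  exact u.2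

variable {𝕜 𝔤}

/-- Every morphism from `𝔤` to a weakly complete algebra extends linearly to the envelope. -/
lemma exists_linear_extension {A : Type u} [Ring A] [Algebra 𝕜 A] [TopologicalSpace A]
    [ContinuousMul A] [WeaklyComplete 𝕜 A] (f : 𝔤 →L[𝕜] A) (hf : IsLieMorphism f) :
    ∃ G : envelope 𝕜 𝔤 →L[𝕜] A, ∀ t,
      G (FreeAlgebra.lift 𝕜 (envelopeIncl 𝕜 𝔤) t) = FreeAlgebra.lift 𝕜 f t := by
  obtain ⟨J, ⟨e⟩⟩ := WeaklyComplete.exists_equiv (𝕜 := 𝕜) (E := A)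
  choose n ρ l h using fun j => exists_matrix_coefficient
    ((ContinuousLinearMap.proj j).comp (e : A →L[𝕜] (J → 𝕜)))
  -- The `j`-th coordinate of `A` is a coefficient of `ρ j`, and `ρ j ∘ f` is one of the factors of
  -- the product. The coordinate can thus be read off from that factor.
  let r : J → MatrixRep 𝕜 𝔤 := fun j => ⟨n j, (ρ j).toContinuousLinearMap.comp f, fun x y => by
    simp [hf x y]⟩
  let G₀ : MatrixProduct 𝕜 𝔤 →L[𝕜] (J → 𝕜) := ContinuousLinearMap.pi fun j =>
    (LinearMap.toContinuousLinearMap (l j)).comp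
      (ContinuousLinearMap.proj (R := 𝕜) (φ := fun i : MatrixRep 𝕜 𝔤 =>
        Matrix (Fin i.1) (Fin i.1) 𝕜) (r j))
  refine ⟨(e.symm : (J → 𝕜) →L[𝕜] A).comp
    (G₀.comp (Subalgebra.toSubmodule (envelope 𝕜 𝔤)).subtypeL), fun t => ?_⟩
  apply e.injective
  ext j
  have h1 : (Pi.evalAlgHom 𝕜 (fun i : MatrixRep 𝕜 𝔤 => Matrix (Fin i.1) (Fin i.1) 𝕜) (r j)).comp
      (FreeAlgebra.lift 𝕜 (universalRep 𝕜 𝔤)) =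
      (ρ j : A →ₐ[𝕜] Matrix (Fin (n j)) (Fin (n j)) 𝕜).comp (FreeAlgebra.lift 𝕜 f) := by
    ext x : 2
    simp only [Function.comp_apply, AlgHom.comp_apply, FreeAlgebra.lift_ι_apply]
    rfl
  have h2 : FreeAlgebra.lift 𝕜 (universalRep 𝕜 𝔤) t (r j) = ρ j (FreeAlgebra.lift 𝕜 f t) :=
    DFunLike.congr_fun h1 t
  have h3 := h j (FreeAlgebra.lift 𝕜 f t)
  rw [← h2, ← coe_lift_envelopeIncl] at h3
  refine Eq.trans ?_ h3.symm
  exact congrFun (e.apply_symm_apply _) j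

variable (𝕜 𝔤) in
-- The linear extension depends on choices of coordinates and coefficients, but it is multiplicative
-- on the dense subalgebra generated by `𝔤`. Density gives multiplicativity everywhere, and likewise
-- uniqueness, as `A` is Hausdorff.
theorem isWeaklyCompleteEnvelopingAlgebra_envelope :
    IsWeaklyCompleteEnvelopingAlgebra (envelopeIncl 𝕜 𝔤) where
  isLieMorphism x y := Subtype.ext (funext fun i => i.2.2 x y)
  existsUnique_lift A _ _ _ _ _ f hf := by
    have := WeaklyComplete.t2Space 𝕜 A
    have hd := denseRange_lift_envelopeIncl 𝕜 𝔤
    obtain ⟨G, hG⟩ := exists_linear_extension f hf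
    have hG1 : G 1 = 1 := by
      have := hG 1
      rwa [map_one (FreeAlgebra.lift 𝕜 (envelopeIncl 𝕜 𝔤)), map_one (FreeAlgebra.lift 𝕜 f)] at this
    have hGm : ∀ u v, G (u * v) = G u * G v := by
      intro u v
      refine hd.induction_on₂ (p := fun u v => G (u * v) = G u * G v) ?_ (fun s t => ?_) u v
      · exact isClosed_eq (by fun_prop) (by fun_prop)
      · rw [← map_mul, hG, hG, hG, map_mul]
    refine ⟨⟨AlgHom.ofLinearMap G hG1 hGm, G.continuous⟩, fun x => ?_, fun F hF => ?_⟩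
    · have := hG (FreeAlgebra.ι 𝕜 x)
      rwa [FreeAlgebra.lift_ι_apply, FreeAlgebra.lift_ι_apply] at this
    · have h : (F : envelope 𝕜 𝔤 →ₐ[𝕜] A).comp (FreeAlgebra.lift 𝕜 (envelopeIncl 𝕜 𝔤)) =
          FreeAlgebra.lift 𝕜 f := by
        ext x : 2
        simpa using hF x
      have hfun : (F : envelope 𝕜 𝔤 → A) = G := by
        refine hd.equalizer F.cont G.continuous (funext fun t => ?_)
        exact (DFunLike.congr_fun h t).trans (hG t).symm
      exact DFunLike.coe_injective hfun

end Existence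

/-! ### The inclusion into the enveloping algebra is not zero -/

section NonzeroMorphism

lemma weaklyComplete_matrix (𝕜 : Type) [RCLike 𝕜] (n : Type u) :
    WeaklyComplete 𝕜 (Matrix n n 𝕜) where
  exists_equiv := ⟨n × n, ⟨{
    toFun := fun M k => M k.1 k.2
    invFun := fun x => Matrix.of fun a b => x (a, b)
    map_add' := fun _ _ => rfl
    map_smul' := fun _ _ => rfl
    left_inv := fun _ => rfl
    right_inv := fun _ => rfl
    continuous_toFun := continuous_pi fun k => Continuous.matrix_elem continuous_id k.1 k.2
    continuous_invFun := continuous_matrix fun _ _ => continuous_apply _ }⟩⟩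

variable {𝕜 : Type} [RCLike 𝕜] {𝔤 : Type u} [LieRing 𝔤] [LieAlgebra 𝕜 𝔤]

/-- The action of `𝔤` on its quotient by an ideal. -/
def quotientAd (I : LieIdeal 𝕜 𝔤) : 𝔤 →ₗ[𝕜] Module.End 𝕜 (𝔤 ⧸ I.toSubmodule) where
  toFun x := I.toSubmodule.mapQ I.toSubmodule (LieModule.toEnd 𝕜 𝔤 𝔤 x) fun _ hy => I.lie_mem hy
  map_add' x y := by
    refine LinearMap.ext fun q => ?_
    obtain ⟨z, rfl⟩ := Submodule.Quotient.mk_surjective _ q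
    exact congrArg Submodule.Quotient.mk (add_lie x y z)
  map_smul' c x := by
    refine LinearMap.ext fun q => ?_
    obtain ⟨z, rfl⟩ := Submodule.Quotient.mk_surjective _ q
    exact congrArg Submodule.Quotient.mk (smul_lie c x z)

lemma quotientAd_mk (I : LieIdeal 𝕜 𝔤) (x y : 𝔤) :
    quotientAd I x (Submodule.Quotient.mk y) = Submodule.Quotient.mk ⁅x, y⁆ := rfl

lemma quotientAd_lie (I : LieIdeal 𝕜 𝔤) (x y : 𝔤) : quotientAd I ⁅x, y⁆ =
    quotientAd I x * quotientAd I y - quotientAd I y * quotientAd I x := by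
  refine LinearMap.ext fun q => ?_
  obtain ⟨z, rfl⟩ := Submodule.Quotient.mk_surjective _ q
  simp only [LinearMap.sub_apply, Module.End.mul_apply, quotientAd_mk, lie_lie,
    Submodule.Quotient.mk_sub]

/-- A nonzero profinite-dimensional Lie algebra has a nonzero morphism into a weakly complete
algebra. -/
lemma exists_isLieMorphism_ne_zero [TopologicalSpace 𝔤] [IsTopologicalAddGroup 𝔤] [ContinuousSMul 𝕜 𝔤] [Nontrivial 𝔤]
    (h𝔤 : IsProfiniteDimensional 𝕜 𝔤) :
    ∃ (A : Type u) (_ : Ring A) (_ : Algebra 𝕜 A) (_ : TopologicalSpace A) (_ : ContinuousMul A)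
      (_ : WeaklyComplete 𝕜 A) (f : 𝔤 →L[𝕜] A), IsLieMorphism f ∧ ∃ x, f x ≠ 0 := by
  classical
  obtain ⟨x₀, y₀, hne⟩ := exists_pair_ne 𝔤
  obtain ⟨⟨I, hI, hfin⟩, hIne⟩ := Function.ne_iff.mp (h𝔤.isEmbedding.injective.ne hne)
  have : IsClosed (I.toSubmodule : Set 𝔤) := hI
  have hmk : Continuous (Submodule.Quotient.mk : 𝔤 → 𝔤 ⧸ I.toSubmodule) :=
    I.toSubmodule.mkQL.continuous
  -- If `𝔤 ⧸ I` is abelian, its adjoint action vanishes, but any linear form on it is a morphism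
  -- into the commutative algebra `𝕜`.
  by_cases hab : ∀ x y : 𝔤, (Submodule.Quotient.mk ⁅x, y⁆ : 𝔤 ⧸ I.toSubmodule) = 0
  · have hx : (Submodule.Quotient.mk (x₀ - y₀) : 𝔤 ⧸ I.toSubmodule) ≠ 0 := by
      rw [Submodule.Quotient.mk_sub]
      exact sub_ne_zero.mpr hIne
    obtain ⟨l, hl⟩ : ∃ l : Module.Dual 𝕜 (𝔤 ⧸ I.toSubmodule),
        l (Submodule.Quotient.mk (x₀ - y₀)) ≠ 0 := by
      by_contra! h
      exact hx ((Module.forall_dual_apply_eq_zero_iff 𝕜 _).mp h)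
    let f : 𝔤 →L[𝕜] ULift.{u} 𝕜 :=
      (ContinuousLinearEquiv.ulift.symm : 𝕜 ≃L[𝕜] ULift.{u} 𝕜).toContinuousLinearMap.comp
        ((LinearMap.toContinuousLinearMap l).comp I.toSubmodule.mkQL)
    refine ⟨ULift.{u} 𝕜, inferInstance, inferInstance, inferInstance, inferInstance, inferInstance,
      f, fun x y => ?_, x₀ - y₀, fun h => hl (congrArg ULift.down h)⟩
    rw [mul_comm, sub_self]
    have : f ⁅x, y⁆ = ULift.up (l (Submodule.Quotient.mk ⁅x, y⁆)) := rfl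
    rw [this, hab, map_zero]
    rfl
  · push Not at hab
    obtain ⟨x₁, y₁, hxy⟩ := hab
    -- The index type of this basis lies in universe `u`, so the matrix algebra does too, as the
    -- universal property requires.
    let b := Module.Basis.ofVectorSpace 𝕜 (𝔤 ⧸ I.toSubmodule)
    let M := LinearMap.toMatrixAlgEquiv b
    have hc : Continuous fun x => M (quotientAd I x) := by
      refine continuous_matrix fun i j => ?_
      obtain ⟨y, hy⟩ := Submodule.Quotient.mk_surjective _ (b j)
      have : ∀ x, M (quotientAd I x) i j = b.coord i (Submodule.Quotient.mk ⁅x, y⁆) := by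
        intro x
        rw [LinearMap.toMatrixAlgEquiv_apply, ← hy, quotientAd_mk]
        rfl
      simp only [this]
      exact (LinearMap.continuous_of_finiteDimensional (b.coord i)).comp
        (hmk.comp (h𝔤.continuous_lie.comp (continuous_id.prodMk continuous_const)))
    let f : 𝔤 →L[𝕜] Matrix _ _ 𝕜 := ⟨M.toLinearMap ∘ₗ quotientAd I, hc⟩
    refine ⟨_, inferInstance, inferInstance, inferInstance, inferInstance,
      weaklyComplete_matrix 𝕜 _, f, fun x y => ?_, x₁, fun h => hxy ?_⟩
    · change M (quotientAd I ⁅x, y⁆) = M _ * M _ - M _ * M _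
      rw [quotientAd_lie, map_sub, map_mul, map_mul]
    · have h0 : quotientAd I x₁ = 0 := M.injective (h.trans (map_zero M).symm)
      rw [← quotientAd_mk, h0]
      rfl

end NonzeroMorphism

/-- Every morphism into a weakly complete algebra factors through `incl`, so a single nonzero one
suffices. -/
lemma IsWeaklyCompleteEnvelopingAlgebra.exists_incl_ne_zero {𝕜 : Type} [RCLike 𝕜] {𝔤 : Type u}
    [LieRing 𝔤] [LieAlgebra 𝕜 𝔤] [TopologicalSpace 𝔤] [IsTopologicalAddGroup 𝔤]
    [ContinuousSMul 𝕜 𝔤] [Nontrivial 𝔤] (h𝔤 : IsProfiniteDimensional 𝕜 𝔤) {U : Type u} [Ring U]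
    [Algebra 𝕜 U] [TopologicalSpace U] [ContinuousMul U] [WeaklyComplete 𝕜 U] {incl : 𝔤 →L[𝕜] U}
    (hU : IsWeaklyCompleteEnvelopingAlgebra incl) : ∃ x, incl x ≠ 0 := by
  obtain ⟨A, _, _, _, _, _, f, hf, x, hx⟩ := exists_isLieMorphism_ne_zero h𝔤
  obtain ⟨F, hF, -⟩ := hU.existsUnique_lift A f hf
  refine ⟨x, fun h => hx ?_⟩
  rw [← hF, h, map_zero]

end

theorem corollary3p6 (𝕜 : Type) [RCLike 𝕜] (𝔤 : Type u) [LieRing 𝔤] [LieAlgebra 𝕜 𝔤]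
    [TopologicalSpace 𝔤] [IsTopologicalAddGroup 𝔤] [ContinuousSMul 𝕜 𝔤] [Nontrivial 𝔤]
    (h𝔤 : IsProfiniteDimensional 𝕜 𝔤) :
    (∃ (U : Type u) (_ : Ring U) (_ : Algebra 𝕜 U) (_ : TopologicalSpace U) (_ : ContinuousMul U)
      (_ : WeaklyComplete 𝕜 U) (incl : 𝔤 →L[𝕜] U), IsWeaklyCompleteEnvelopingAlgebra incl) ∧
    (∀ (U : Type u) [Ring U] [Algebra 𝕜 U] [TopologicalSpace U] [ContinuousMul U]
      [WeaklyComplete 𝕜 U] (incl : 𝔤 →L[𝕜] U) (hU : IsWeaklyCompleteEnvelopingAlgebra incl),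
      (∃ a : U, hU.IsGrouplike a ∧ a ≠ 1) ∧
      (∀ x : 𝔤, ∃ e : U, IsExp 𝕜 (incl x) e ∧ hU.IsGrouplike e) ∧
      (∃ x : 𝔤, incl x ≠ 0) ∧
      (∀ x : 𝔤, incl x ≠ 0 →
        ∀ᶠ t in 𝓝[≠] (0 : 𝕜), ∃ e : U, IsExp 𝕜 (incl (t • x)) e ∧ e ≠ 1)) ∧
    (∀ (L : Type*) [LieRing L] [LieAlgebra 𝕜 L] (a : UniversalEnvelopingAlgebra 𝕜 L),
      IsGroupLikeElem 𝕜 a ↔ a = 1) := by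
  refine ⟨⟨envelope 𝕜 𝔤, inferInstance, inferInstance, inferInstance, inferInstance, inferInstance,
    envelopeIncl 𝕜 𝔤, isWeaklyCompleteEnvelopingAlgebra_envelope 𝕜 𝔤⟩, ?_,
    fun L _ _ a => ClassicalEnveloping.isGroupLikeElem_iff a⟩
  intro U _ _ _ _ _ incl hU
  have hsmall : ∀ x : 𝔤, incl x ≠ 0 →
      ∀ᶠ t in 𝓝[≠] (0 : 𝕜), ∃ e : U, IsExp 𝕜 (incl (t • x)) e ∧ e ≠ 1 := by
    intro x hx
    filter_upwards [eventually_exp_ne_one hx] with t ht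
    obtain ⟨e, he⟩ := exists_isExp (𝕜 := 𝕜) (incl (t • x))
    refine ⟨e, he, fun h1 => ht ?_⟩
    rwa [h1, map_smul] at he
  have hne := hU.exists_incl_ne_zero h𝔤
  refine ⟨?_, fun x => ?_, hne, hsmall⟩
  · obtain ⟨x, hx⟩ := hne
    obtain ⟨t, e, he, h1⟩ := (hsmall x hx).exists
    exact ⟨e, hU.isGrouplike_of_isExp he, h1⟩
  · obtain ⟨e, he⟩ := exists_isExp (𝕜 := 𝕜) (incl x)
    exact ⟨e, he, hU.isGrouplike_of_isExp he⟩
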